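/- Let $T,L>0$ and consider, in $Q_T=\{0\le t<T,\ 0\le x\le L,\ 0\le y<\infty\}$, the Prandtl problem $$\partial_t u+u\,\partial_x u+v\,\partial_y u=\partial_y^2u-\partial_xP,\qquad \partial_x u+\partial_y v=0,$$ $$u|_{y=0}=v|_{y=0}=0,\qquad \lim_{y\to\infty}u=U_e(t,x),\qquad u|_{t=0}=u_0(x,y),\qquad u|_{x=0}=u_1(t,y),$$ where $\partial_tU_e+U_e\partial_xU_e=-\partial_xP$. Assume that $U_e\in C^1([0,T]\times[0,L])$, that $U_e>0$ and $\partial_xP>0$ on $[0,T]\times[0,L]$, and that the data are positive off the wall and strictly monotone: $u_0(x,y)>0$, $u_1(t,y)>0$ for $y>0$, and $\partial_yu_0(x,y)>0$, $\partial_yu_1(t,y)>0$ for $y\ge0$ ($0\le t<T$, $0\le x\le L$). A classical solution is a pair $(u,v)$ satisfying the problem pointwise in $Q_T$ such that $u,\partial_tu,\partial_xu,\partial_yu,\partial_y^2u$ and $v$ are continuous on $Q_T$; $\partial_t\partial_yu,\ \partial_x\partial_yu,\ \partial_y^3u$ exist and are continuous in the interior of $Q_T$; and, on $[0,T']\times[0,L]\times[0,\infty)$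 for every $T'<T$, the derivatives $\partial_xu,\partial_yu$ are bounded and $u\to U_e$ as $y\to\infty$ uniformly in $(t,x)$. Let $(u,v)$ be a classical solution. A first zero of $\partial_yu$ is a point $(t_0,x_0,y_0)\in Q_T$ with $t_0>0$, $\partial_yu(t_0,x_0,y_0)=0$, and $\partial_yu(t,x,y)\neq0$ for all $0\le t<t_0$, $x\in[0,L]$, $y\ge0$. (1) Every first zero $(t_0,x_0,y_0)$ of $\partial_yu$ lies on the boundary, i.e. $y_0=0$; and if $\partial_yu$ vanishes somewhere in $Q_T$ at a time $t>0$, then a first zero exists. (2) There is a constant $C_*>0$, depending only on $L$, $T$, $U_e$ and $\partial_xP$ (and not on $u_0,u_1,u,v$), such that if $$\int_0^\infty\!\!\int_0^L\frac{(L-x)^{3/2}\,\partial_yu_0}{\sqrt{(\partial_yu_0)^2+u_0^2}}\,dx\,dy\ \ge\ C_*,$$ then there is a back flow point $(t^*,x^*)\in(0,T)\times[0,L]$, that is, $$\partial_yu(t^*,x^*,0)=0,\qquad \partial_yu(t,x,y)>0\quad\text{for all }0\le t<t^*,\ x\in[0,L],\ y\ge0;$$ moreover $\partial_y^2u(t^*,x^*,0)=\partial_xP(t^*,x^*)\neq0$.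 -/

import Mathlib

open Set Filter Topology MeasureTheory

noncomputable section

namespace Prandtl

/-- The domain `{0 ≤ t < T, 0 ≤ x ≤ L, 0 ≤ y < ∞}` of the boundary layer. -/
def domain (T L : ℝ) : Set (ℝ × ℝ × ℝ) := Ico 0 T ×ˢ Icc 0 L ×ˢ Ici 0

/-- The open domain `{0 < t < T, 0 < x < L, 0 < y < ∞}`. -/
def openDomain (T L : ℝ) : Set (ℝ × ℝ × ℝ) := Ioo 0 T ×ˢ Ioo 0 L ×ˢ Ioi 0

/-- `∂_t f` on the domain (one-sided at `t = 0`). -/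
def partialT (T : ℝ) (f : ℝ → ℝ → ℝ → ℝ) (t x y : ℝ) : ℝ :=
  derivWithin (fun s => f s x y) (Ico 0 T) t

/-- `∂_x f` on the domain (one-sided at `x = 0` and `x = L`). -/
def partialX (L : ℝ) (f : ℝ → ℝ → ℝ → ℝ) (t x y : ℝ) : ℝ :=
  derivWithin (fun s => f t s y) (Icc 0 L) x

/-- `∂_y f` on the domain (one-sided at the wall `y = 0`). -/
def partialY (f : ℝ → ℝ → ℝ → ℝ) (t x y : ℝ) : ℝ :=
  derivWithin (fun s => f t x s) (Ici 0) y

/-- The partial derivatives `∂_t f`, `∂_x f`, `∂_y f`, `∂_y² f` exist at every point of `D`, and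
they and `f` are continuous on `D`. It is used for `D = domain T L` and `D = openDomain T L`. -/
structure IsC112On (T L : ℝ) (f : ℝ → ℝ → ℝ → ℝ) (D : Set (ℝ × ℝ × ℝ)) : Prop where
  diff_t : ∀ q ∈ D, DifferentiableWithinAt ℝ (fun s => f s q.2.1 q.2.2) (Ico 0 T) q.1
  diff_x : ∀ q ∈ D, DifferentiableWithinAt ℝ (fun s => f q.1 s q.2.2) (Icc 0 L) q.2.1
  diff_y : ∀ q ∈ D, DifferentiableWithinAt ℝ (fun s => f q.1 q.2.1 s) (Ici 0) q.2.2
  diff_yy : ∀ q ∈ D, DifferentiableWithinAt ℝ (fun s => partialY f q.1 q.2.1 s) (Ici 0) q.2.2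
  cont : ContinuousOn (fun q : ℝ × ℝ × ℝ => f q.1 q.2.1 q.2.2) D
  cont_t : ContinuousOn (fun q : ℝ × ℝ × ℝ => partialT T f q.1 q.2.1 q.2.2) D
  cont_x : ContinuousOn (fun q : ℝ × ℝ × ℝ => partialX L f q.1 q.2.1 q.2.2) D
  cont_y : ContinuousOn (fun q : ℝ × ℝ × ℝ => partialY f q.1 q.2.1 q.2.2) D
  cont_yy : ContinuousOn (fun q : ℝ × ℝ × ℝ => partialY (partialY f) q.1 q.2.1 q.2.2) D

/-- The pressure gradient `∂_x P (t, x)` for `x ∈ [0, L]`. -/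
def pressureGradient (L : ℝ) (P : ℝ → ℝ → ℝ) (t x : ℝ) : ℝ :=
  derivWithin (fun s => P t s) (Icc 0 L) x

/-- Bernoulli's law `∂_t U_e + U_e ∂_x U_e = -∂_x P` on `[0, T] × [0, L]`. -/
def Bernoulli (T L : ℝ) (Ue P : ℝ → ℝ → ℝ) : Prop :=
  ∀ t ∈ Icc 0 T, ∀ x ∈ Icc 0 L,
    derivWithin (fun s => Ue s x) (Icc 0 T) t +
      Ue t x * derivWithin (fun s => Ue t s) (Icc 0 L) x = -pressureGradient L P t x

/-- The pressure gradient is adverse on `[0, T] × [0, L]`. -/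
def AdversePressure (T L : ℝ) (P : ℝ → ℝ → ℝ) : Prop :=
  ∀ t ∈ Icc 0 T, ∀ x ∈ Icc 0 L, 0 < pressureGradient L P t x

/-- The initial and inflow data are positive off the wall and strictly monotone in `y`, up to
the wall. (On the wall itself the data vanish, by the no-slip condition.) -/
structure MonotoneData (T L : ℝ) (u₀ u₁ : ℝ → ℝ → ℝ) : Prop where
  pos_initial : ∀ x ∈ Icc 0 L, ∀ y > 0, 0 < u₀ x y
  pos_inflow : ∀ t ∈ Ico 0 T, ∀ y > 0, 0 < u₁ t y
  mono_initial : ∀ x ∈ Icc 0 L, ∀ y ≥ 0, 0 < derivWithin (fun s => u₀ x s) (Ici 0) y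
  mono_inflow : ∀ t ∈ Ico 0 T, ∀ y ≥ 0, 0 < derivWithin (fun s => u₁ t s) (Ici 0) y

/-- `(u, v)` is a classical solution, for `0 ≤ t < T`, of the Prandtl problem with outer flow
`(U_e, P)`, initial velocity `u₀` and inflow velocity `u₁`. -/
structure IsClassicalSolution (T L : ℝ) (Ue P u₀ u₁ : ℝ → ℝ → ℝ)
    (u v : ℝ → ℝ → ℝ → ℝ) : Prop where
  regular_u : IsC112On T L u (domain T L)
  /-- The vorticity has the derivatives that occur in the vorticity equation, in the interior. -/
  regular_uy : IsC112On T L (partialY u) (openDomain T L)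
  cont_v : ContinuousOn (fun q : ℝ × ℝ × ℝ => v q.1 q.2.1 q.2.2) (domain T L)
  diff_v : ∀ q ∈ domain T L, DifferentiableWithinAt ℝ (fun s => v q.1 q.2.1 s) (Ici 0) q.2.2
  momentum : ∀ t ∈ Ico 0 T, ∀ x ∈ Icc 0 L, ∀ y ≥ 0,
    partialT T u t x y + u t x y * partialX L u t x y + v t x y * partialY u t x y =
      partialY (partialY u) t x y - pressureGradient L P t x
  incompressible : ∀ t ∈ Ico 0 T, ∀ x ∈ Icc 0 L, ∀ y ≥ 0,
    partialX L u t x y + partialY v t x y = 0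
  wall_u : ∀ t ∈ Ico 0 T, ∀ x ∈ Icc 0 L, u t x 0 = 0
  wall_v : ∀ t ∈ Ico 0 T, ∀ x ∈ Icc 0 L, v t x 0 = 0
  /-- `u → U_e` as `y → ∞`, uniformly in `x` and locally uniformly in `t`. -/
  far_field : ∀ T' < T, TendstoUniformlyOn (fun (y : ℝ) (q : ℝ × ℝ) => u q.1 q.2 y)
    (fun q => Ue q.1 q.2) atTop (Icc 0 T' ×ˢ Icc 0 L)
  /-- `∂_x u` and `∂_y u` are bounded, locally uniformly in `t`. -/
  bounded : ∀ T' < T, ∃ M : ℝ, ∀ t ∈ Icc 0 T', ∀ x ∈ Icc 0 L, ∀ y ≥ 0,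
    |partialX L u t x y| ≤ M ∧ |partialY u t x y| ≤ M
  initial : ∀ x ∈ Icc 0 L, ∀ y ≥ 0, u 0 x y = u₀ x y
  inflow : ∀ t ∈ Ico 0 T, ∀ y ≥ 0, u t 0 y = u₁ t y

/-- `(t₀, x₀, y₀)` is a first zero of `∂_y u` as time evolves. -/
structure IsFirstCriticalPoint (T L : ℝ) (u : ℝ → ℝ → ℝ → ℝ) (t₀ x₀ y₀ : ℝ) : Prop where
  mem_t : t₀ ∈ Ioo 0 T
  mem_x : x₀ ∈ Icc 0 L
  mem_y : 0 ≤ y₀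
  zero : partialY u t₀ x₀ y₀ = 0
  first : ∀ t ∈ Ico 0 t₀, ∀ x ∈ Icc 0 L, ∀ y ≥ 0, partialY u t x y ≠ 0

/-- `(t₀, x₀, 0)` is a back flow point of `u`. -/
def IsBackFlowPoint (u : ℝ → ℝ → ℝ → ℝ) (t₀ x₀ : ℝ) : Prop :=
  partialY u t₀ x₀ 0 = 0 ∧ ∀ t ∈ Ioo 0 t₀, ∀ x ∈ Ioo 0 x₀, 0 < partialY u t x 0

/-- `∫_0^∞ ∫_0^L (L - x)^{3/2} ∂_y u₀ / √((∂_y u₀)² + u₀²) dx dy`, with values in `[0, ∞]`; the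
integrand is nonnegative when `u₀` is monotone in `y`. -/
def initialFunctional (L : ℝ) (u₀ : ℝ → ℝ → ℝ) : ENNReal :=
  ∫⁻ y in Ioi (0 : ℝ), ∫⁻ x in Icc 0 L, ENNReal.ofReal
    ((L - x) ^ (3 / 2 : ℝ) * derivWithin (fun s => u₀ x s) (Ici 0) y /
      √(derivWithin (fun s => u₀ x s) (Ici 0) y ^ 2 + u₀ x y ^ 2))

end Prandtl

end

/-! Write w = ∂_y u. Differentiating the momentum equation in y and using incompressibility gives
w_t + u w_x + v w_y = w_yy, with no forcing and no zeroth-order term (`vorticity`). While u ≥ 0,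
fluid leaves through x = L, so w obeys a comparison principle that needs no condition there
(`comparison`). Barriers then show that w ≥ 0 forces w > 0 off the wall (`uy_pos_of_nonneg`) and
that w stays nonnegative far from the wall (`uy_nonneg_of_far`). Hence w can first vanish only on
the wall. A continuation argument in time (`uy_pos_of_wall_pos`) and compactness of the wall produce
a first zero (`exists_firstCriticalPoint`).

For (2), suppose w > 0 throughout Q_T and put ρ = √(w² + u²), F = w/ρ. Then F_t + u F_x + v F_y ≥
F_yy + ∂_xP · uw/ρ³ - F/3 (`ratioYY_le`): an adverse pressure gradient feeds F. Integrated in y,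
diffusion and normal transport leave only bounded terms, because F_y and v vanish on the wall.
Integrated in x against the decreasing weight (L - x)^{3/2}, the tangential flux costs a constant,
because uF ≤ w and ∫ w dy ≤ U_e.

The source is cubic in the weighted integral A of F. Indeed F = (uw/ρ³)^{1/3} (w/√u)^{2/3} and ∫
w/√u dy = 2√u ≤ 2√U_e, so Hölder's inequality bounds the source below by a multiple of A³. It is
used in a linearised form with a free parameter λ (`angle_young`), chosen at the end in terms of A.
The result is A' ≥ cA³ - A - C, where c and C depend only on L, an upper bound of U_e and a lower
bound of ∂_xP. A large A(0) would make A blow up before T/2 (`false_of_superquadratic`), so w must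
vanish somewhere, and (1) gives the back flow point.

The derivatives of w exist only in the interior, so the estimate is carried out on boxes [δ, L - δ]
× [δ, 1/δ] with a cutoff in y and constants independent of δ. Fatou's lemma
(`lintegral_le_of_frequently`) relates these boxes to the full initial integral. -/

namespace Prandtl

/-! ### Calculus: extrema, parametric integrals, mixed partials, finite-time blow-up. -/

/-- Second derivative test, necessary condition. -/
theorem second_deriv_nonneg_of_isLocalMin {f f' : ℝ → ℝ} {f'' x : ℝ} (hmin : IsLocalMin f x)
    (hf : ∀ᶠ s in 𝓝 x, HasDerivAt f (f' s) s) (hf' : HasDerivAt f' f'' x) : 0 ≤ f'' := by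
  by_contra! hneg
  have hd : deriv f =ᶠ[𝓝 x] f' := hf.mono fun s hs => hs.deriv
  have hdd : deriv (deriv f) x = f'' := by rw [hd.deriv_eq]; exact hf'.deriv
  have h0 : deriv f x = 0 := hmin.deriv_eq_zero
  -- A negative second derivative would make the minimum a local maximum as well, so f would be
  -- locally constant and its second derivative zero.
  have hmax := isLocalMax_of_deriv_deriv_neg (hdd ▸ hneg) h0 hf.self_of_nhds.continuousAt
  have hc : f =ᶠ[𝓝 x] fun _ => f x := by
    filter_upwards [hmin, hmax] with s h1 h2 using le_antisymm h2 h1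
  have hz : deriv f =ᶠ[𝓝 x] fun _ => 0 := by
    filter_upwards [hc.eventuallyEq_nhds] with s hs
    rw [hs.deriv_eq, deriv_const]
  have : deriv (deriv f) x = 0 := by rw [hz.deriv_eq, deriv_const]
  linarith [hdd]

/-- The derivative from the left is nonpositive at a minimum over `[a, b]` other than `a`. -/
theorem deriv_nonpos_of_isMinOn_Icc {f : ℝ → ℝ} {f' a b t : ℝ} (ht : t ∈ Ioc a b)
    (hmin : ∀ s ∈ Icc a b, f t ≤ f s) (hf : HasDerivAt f f' t) : f' ≤ 0 := by
  have h2 := (hasDerivWithinAt_iff_tendsto_slope' (s := Iio t) (by simp)).1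
    (hf.hasDerivWithinAt (s := Iio t))
  refine le_of_tendsto h2 ?_
  filter_upwards [Ioo_mem_nhdsLT ht.1] with s hs
  rw [slope_def_field]
  exact div_nonpos_of_nonneg_of_nonpos (sub_nonneg.2 (hmin s ⟨hs.1.le, hs.2.le.trans ht.2⟩))
    (sub_nonpos.2 hs.2.le)

/-- Projecting y onto [a, b] extends the integrand continuously to all real y without changing the
integral, which reduces the claim to the global statement on the compact space S. -/
theorem continuousOn_intervalIntegral {X : Type*} [TopologicalSpace X] [FirstCountableTopology X]
    [T2Space X] {S : Set X} (hS : IsCompact S) {a b : ℝ} (hab : a ≤ b) {f : X → ℝ → ℝ}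
    (hf : ContinuousOn (fun q : X × ℝ => f q.1 q.2) (S ×ˢ Icc a b)) :
    ContinuousOn (fun s => ∫ y in a..b, f s y) S := by
  have : CompactSpace S := isCompact_iff_compactSpace.1 hS
  rw [continuousOn_iff_continuous_domRestrict]
  have h : Continuous (fun q : S × ℝ => f q.1 (projIcc a b hab q.2)) := by
    refine hf.comp_continuous (f := fun q : S × ℝ => ((q.1 : X), (projIcc a b hab q.2 : ℝ)))
      (by fun_prop) fun q => ⟨q.1.2, (projIcc a b hab q.2).2⟩
  have h2 := intervalIntegral.continuous_parametric_intervalIntegral_of_continuous'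
    (μ := volume) (f := fun (s : S) (y : ℝ) => f s (projIcc a b hab y)) h a b
  refine h2.congr fun s => intervalIntegral.integral_congr fun y hy => ?_
  rw [uIcc_of_le hab] at hy
  simp [projIcc_of_mem hab hy]

/-- Dominated differentiation under the integral sign. The dominating constant comes from a compact
subinterval around s, so nothing is needed of the derivative at the ends α and β. -/
theorem hasDerivAt_intervalIntegral {α β c d s : ℝ} (hs : s ∈ Ioo α β) (hcd : c ≤ d)
    {f f' : ℝ → ℝ → ℝ}
    (hf : ∀ r ∈ Ioo α β, ContinuousOn (f r) (Icc c d))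
    (hf' : ContinuousOn (fun q : ℝ × ℝ => f' q.1 q.2) (Ioo α β ×ˢ Icc c d))
    (hd : ∀ r ∈ Ioo α β, ∀ y ∈ Icc c d, HasDerivAt (fun r => f r y) (f' r y) r) :
    HasDerivAt (fun r => ∫ y in c..d, f r y) (∫ y in c..d, f' s y) s := by
  obtain ⟨a, ha1, ha2⟩ := exists_between hs.1
  obtain ⟨b, hb1, hb2⟩ := exists_between hs.2
  have hsub : Icc a b ⊆ Ioo α β := fun r hr => ⟨ha1.trans_le hr.1, hr.2.trans_lt hb2⟩
  obtain ⟨C, hC⟩ := (isCompact_Icc.prod isCompact_Icc).exists_bound_of_continuousOn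
    (hf'.mono (prod_mono hsub Subset.rfl))
  have hI : uIoc c d ⊆ Icc c d := by rw [uIoc_of_le hcd]; exact Ioc_subset_Icc_self
  have hm : ∀ {g : ℝ → ℝ}, ContinuousOn g (Icc c d) →
      AEStronglyMeasurable g (volume.restrict (uIoc c d)) := fun hg =>
    (hg.mono hI).aestronglyMeasurable measurableSet_uIoc
  refine (intervalIntegral.hasDerivAt_integral_of_dominated_loc_of_deriv_le
    (s := Icc a b) (bound := fun _ => C) (Icc_mem_nhds ha2 hb1) ?_ ?_ ?_ ?_ ?_ ?_).2
  · filter_upwards [Icc_mem_nhds ha2 hb1] with r hr using hm (hf r (hsub hr))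
  · exact ((uIcc_of_le hcd).symm ▸ hf s hs).intervalIntegrable
  · exact hm (hf'.comp (f := fun y => (s, y)) (by fun_prop) fun y hy => ⟨hs, hy⟩)
  · exact ae_of_all _ fun y hy r hr => hC (r, y) ⟨hr, hI hy⟩
  · exact intervalIntegrable_const
  · exact ae_of_all _ fun y hy r hr => hd r (hsub hr) y (hI hy)

/-- Exchange of partial derivatives when one of the mixed derivatives exists and is continuous. -/
theorem hasDerivAt_partial_swap {α β c d : ℝ} {f fs g h : ℝ → ℝ → ℝ}
    (hfs : ∀ r ∈ Ioo α β, ∀ y ∈ Ioo c d, HasDerivAt (fun r => f r y) (fs r y) r)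
    (hfy : ∀ r ∈ Ioo α β, ∀ y ∈ Ioo c d, HasDerivAt (f r) (g r y) y)
    (hg : ∀ r ∈ Ioo α β, ContinuousOn (g r) (Ioo c d))
    (hgs : ∀ r ∈ Ioo α β, ∀ y ∈ Ioo c d, HasDerivAt (fun r => g r y) (h r y) r)
    (hh : ContinuousOn (fun q : ℝ × ℝ => h q.1 q.2) (Ioo α β ×ˢ Ioo c d))
    {s y : ℝ} (hs : s ∈ Ioo α β) (hy : y ∈ Ioo c d) : HasDerivAt (fs s) (h s y) y := by
  obtain ⟨y₁, h1, h2⟩ := exists_between hy.1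
  have hy1 : y₁ ∈ Ioo c d := ⟨h1, h2.trans hy.2⟩
  have hsub : ∀ z ∈ Ioo c d, Icc y₁ z ⊆ Ioo c d := fun z hz r hr =>
    ⟨h1.trans_le hr.1, hr.2.trans_lt hz.2⟩
  have hhs : ContinuousOn (h s) (Ioo c d) :=
    hh.comp (f := fun y => (s, y)) (by fun_prop) fun y hy => ⟨hs, hy⟩
  -- Differentiating f r z - f r y₁ = ∫ g in r under the integral sign expresses `fs s` as a
  -- primitive of h, to which the fundamental theorem of calculus applies.
  have key : ∀ z ∈ Ioo y₁ d, fs s z = fs s y₁ + ∫ r in y₁..z, h s r := by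
    intro z hz
    have hz' : z ∈ Ioo c d := ⟨h1.trans hz.1, hz.2⟩
    have e1 : HasDerivAt (fun r => f r z - f r y₁) (fs s z - fs s y₁) s :=
      (hfs s hs z hz').sub (hfs s hs y₁ hy1)
    have e2 := hasDerivAt_intervalIntegral hs hz.1.le
      (fun r hr => (hg r hr).mono (hsub z hz'))
      (hh.mono (prod_mono Subset.rfl (hsub z hz')))
      (fun r hr y hy => hgs r hr y (hsub z hz' hy))
    have e3 : (fun r => f r z - f r y₁) =ᶠ[𝓝 s] fun r => ∫ y in y₁..z, g r y := by
      filter_upwards [Ioo_mem_nhds hs.1 hs.2] with r hr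
      have hu : uIcc y₁ z = Icc y₁ z := uIcc_of_le hz.1.le
      rw [intervalIntegral.integral_eq_sub_of_hasDerivAt
        (fun y hy => hfy r hr y (hsub z hz' (hu ▸ hy)))
        (ContinuousOn.intervalIntegrable (hu.symm ▸ (hg r hr).mono (hsub z hz')))]
    have := e1.unique (e2.congr_of_eventuallyEq e3)
    linarith
  have h_integral : HasDerivAt (fun z => fs s y₁ + ∫ r in y₁..z, h s r) (h s y) y := by
    refine HasDerivAt.const_add _ ?_
    refine intervalIntegral.integral_hasDerivAt_right
      (ContinuousOn.intervalIntegrable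
        ((uIcc_of_le h2.le).symm ▸ hhs.mono (hsub y hy))) ?_ ?_
    · exact hhs.stronglyMeasurableAtFilter isOpen_Ioo y hy
    · exact hhs.continuousAt (Ioo_mem_nhds hy.1 hy.2)
  refine h_integral.congr_of_eventuallyEq ?_
  filter_upwards [Ioo_mem_nhds h2 hy.2] with z hz using key z hz

/-- A function satisfying a superquadratic differential inequality and starting high enough cannot
exist on `[0, τ]`. -/
theorem false_of_superquadratic {A A' : ℝ → ℝ} {c C τ K : ℝ} (hc : 0 < c) (hC : 0 ≤ C)
    (hτ : 0 < τ) (hA : ContinuousOn A (Icc 0 τ))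
    (hd : ∀ t ∈ Ioo 0 τ, HasDerivAt A (A' t) t)
    (hineq : ∀ t ∈ Ioo 0 τ, 0 ≤ A t → c * A t ^ 3 - A t - C ≤ A' t)
    (hK1 : 1 ≤ K) (hK2 : (C + 2) / c < K) (hK3 : 2 / τ ≤ K) (h0 : K < A 0) : False := by
  obtain ⟨M, hM⟩ := isCompact_Icc.exists_bound_of_continuousOn hA
  have hM' : ∀ t ∈ Icc 0 τ, A t ≤ M := fun t ht => (le_abs_self _).trans (hM t ht)
  have hKpos : 0 < K := by linarith
  have hKτ : 1 / K ≤ τ / 2 := by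
    rw [div_le_div_iff₀ hKpos two_pos]
    have := (div_le_iff₀ hτ).1 hK3
    linarith
  -- The derivative of A is known only for t > 0, so the comparison starts at a slightly later time
  -- t₁ at which A still exceeds K.
  have hev : ∀ᶠ t in 𝓝[>] (0 : ℝ), K < A t ∧ t < τ / 2 ∧ 0 < t := by
    have h1 : ∀ᶠ t in 𝓝[Icc 0 τ] (0 : ℝ), K < A t :=
      (hA 0 ⟨le_rfl, hτ.le⟩).eventually (lt_mem_nhds h0)
    have h2 : 𝓝[>] (0 : ℝ) ≤ 𝓝[Icc 0 τ] (0 : ℝ) := by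
      rw [nhdsWithin_le_iff]; exact Icc_mem_nhdsGT hτ
    filter_upwards [h2 h1, Ioo_mem_nhdsGT (half_pos hτ)] with t h h' using ⟨h, h'.2, h'.1⟩
  obtain ⟨t₁, hK, ht₁, ht₁0⟩ := hev.exists
  have hMK : K < M := hK.trans_le (hM' t₁ ⟨ht₁0.le, by linarith⟩)
  have hM0 : 0 < M := by linarith
  -- The comparison function B solves B' = B² with B(t₁) = K. At t₂ it reaches M + 1, beyond the
  -- bound M of A; K ≥ 2/τ and t₁ < τ/2 place t₂ before τ.
  set t₂ := t₁ + (1 / K - 1 / (M + 1)) with ht₂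
  have hpos : 0 < 1 / (M + 1) := by positivity
  have ht₂τ : t₂ < τ := by linarith
  have ht₁₂ : t₁ < t₂ := by
    have : 1 / (M + 1) < 1 / K := one_div_lt_one_div_of_lt hKpos (by linarith)
    linarith
  let B : ℝ → ℝ := fun t => (1 / K - (t - t₁))⁻¹
  have hden : ∀ t ∈ Icc t₁ t₂, 1 / (M + 1) ≤ 1 / K - (t - t₁) := fun t ht => by linarith [ht.2]
  have hBd : ∀ t ∈ Icc t₁ t₂, HasDerivAt B (B t ^ 2) t := by
    intro t ht
    have h1 : HasDerivAt (fun t => 1 / K - (t - t₁)) (-1) t := by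
      simpa using ((hasDerivAt_id t).sub_const t₁).const_sub (1 / K)
    have hne : 1 / K - (t - t₁) ≠ 0 := by linarith [hden t ht]
    refine (h1.fun_inv hne).congr_deriv ?_
    change _ = ((1 / K - (t - t₁))⁻¹) ^ 2
    field_simp
  have hBK : ∀ t ∈ Icc t₁ t₂, K ≤ B t := by
    intro t ht
    have h := hden t ht
    simp only [B]
    rw [le_inv_comm₀ hKpos (by linarith), ← one_div]
    linarith [ht.1]
  have hle := image_le_of_deriv_right_lt_deriv_boundary' (f := fun t => -A t)
    (f' := fun t => -A' t) (B := fun t => -B t) (B' := fun t => -(B t ^ 2)) (a := t₁) (b := t₂)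
    (hA.neg.mono (Icc_subset_Icc ht₁0.le ht₂τ.le))
    (fun t ht => (hd t ⟨ht₁0.trans_le ht.1, ht.2.trans ht₂τ⟩).neg.hasDerivWithinAt)
    (by simp only [B]; simp; linarith)
    (fun t ht => (hBd t ht).neg.continuousAt.continuousWithinAt)
    (fun t ht => (hBd t ⟨ht.1, ht.2.le⟩).neg.hasDerivWithinAt)
    (by
      intro t ht hAB
      have hAB' : A t = B t := by simpa using hAB
      have hb := hBK t ⟨ht.1, ht.2.le⟩
      have hi := hineq t ⟨ht₁0.trans_le ht.1, ht.2.trans ht₂τ⟩ (by linarith)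
      rw [hAB'] at hi
      -- At a point where A = B ≥ K ≥ 1, cB³ > (C + 2)B² ≥ B² + B + C, hence A' > B² = B'.
      have hcb : C + 2 < c * B t := by
        have := (div_lt_iff₀ hc).1 hK2
        nlinarith
      have hb1 : 1 ≤ B t := hK1.trans hb
      have : (C + 2) * B t ^ 2 < c * B t ^ 3 := by
        have : 0 < B t ^ 2 := by positivity
        nlinarith
      have h3 : B t ≤ B t ^ 2 := by nlinarith
      have h4 : C * 1 ≤ C * B t ^ 2 := mul_le_mul_of_nonneg_left (by nlinarith) hC
      simp only [neg_lt_neg_iff]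
      linarith)
  have h := hle (right_mem_Icc.2 ht₁₂.le)
  have hBt₂ : B t₂ = M + 1 := by
    simp only [B, ht₂]
    rw [show 1 / K - (t₁ + (1 / K - 1 / (M + 1)) - t₁) = 1 / (M + 1) by ring]
    simp
  have := hM' t₂ ⟨by linarith, ht₂τ.le⟩
  simp only [neg_le_neg_iff, hBt₂] at h
  linarith

/-! ### Derivatives of a classical solution, the vorticity equation, elementary bounds. -/

section Regularity

variable {T L : ℝ} {f : ℝ → ℝ → ℝ → ℝ} {D : Set (ℝ × ℝ × ℝ)} {t x y : ℝ}

theorem openDomain_subset : openDomain T L ⊆ domain T L :=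
  prod_mono Ioo_subset_Ico_self (prod_mono Ioo_subset_Icc_self Ioi_subset_Ici_self)

theorem IsC112On.hasDerivAt_t (hf : IsC112On T L f D) (hq : (t, x, y) ∈ D) (ht : t ∈ Ioo 0 T) :
    HasDerivAt (fun s => f s x y) (partialT T f t x y) t :=
  (hf.diff_t _ hq).hasDerivWithinAt.hasDerivAt (Ico_mem_nhds ht.1 ht.2)

theorem IsC112On.hasDerivAt_x (hf : IsC112On T L f D) (hq : (t, x, y) ∈ D) (hx : x ∈ Ioo 0 L) :
    HasDerivAt (fun s => f t s y) (partialX L f t x y) x :=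
  (hf.diff_x _ hq).hasDerivWithinAt.hasDerivAt (Icc_mem_nhds hx.1 hx.2)

theorem IsC112On.hasDerivAt_y (hf : IsC112On T L f D) (hq : (t, x, y) ∈ D) (hy : 0 < y) :
    HasDerivAt (fun s => f t x s) (partialY f t x y) y :=
  (hf.diff_y _ hq).hasDerivWithinAt.hasDerivAt (Ici_mem_nhds hy)

theorem IsC112On.hasDerivAt_yy (hf : IsC112On T L f D) (hq : (t, x, y) ∈ D) (hy : 0 < y) :
    HasDerivAt (fun s => partialY f t x s) (partialY (partialY f) t x y) y :=
  (hf.diff_yy _ hq).hasDerivWithinAt.hasDerivAt (Ici_mem_nhds hy)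

end Regularity

namespace IsClassicalSolution

variable {T L : ℝ} {Ue P u₀ u₁ : ℝ → ℝ → ℝ} {u v : ℝ → ℝ → ℝ → ℝ} {t x y : ℝ}

/-- The vorticity equation. -/
theorem vorticity (h : IsClassicalSolution T L Ue P u₀ u₁ u v) (ht : t ∈ Ioo 0 T)
    (hx : x ∈ Ioo 0 L) (hy : 0 < y) :
    partialT T (partialY u) t x y + u t x y * partialX L (partialY u) t x y +
      v t x y * partialY (partialY u) t x y = partialY (partialY (partialY u)) t x y := by
  have hd : ∀ s ∈ Ioo 0 T, ∀ r ∈ Ioo 0 L, ∀ z, 0 < z → (s, r, z) ∈ openDomain T L :=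
    fun s hs r hr z hz => ⟨hs, hr, hz⟩
  have hd' : ∀ s ∈ Ioo 0 T, ∀ r ∈ Ioo 0 L, ∀ z, 0 < z → (s, r, z) ∈ domain T L :=
    fun s hs r hr z hz => openDomain_subset (hd s hs r hr z hz)
  have hy' : y ∈ Ioo 0 (y + 1) := ⟨hy, by linarith⟩
  have hcw : ∀ s ∈ Ioo 0 T, ∀ r ∈ Ioo 0 L, ContinuousOn (partialY u s r) (Ioo 0 (y + 1)) :=
    fun s hs r hr => h.regular_u.cont_y.comp (f := fun z => (s, r, z)) (by fun_prop)
      fun z hz => hd' s hs r hr z hz.1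
  -- Regularity provides ∂_t∂_y u and ∂_x∂_y u only in this order; exchanging them allows the
  -- momentum equation to be differentiated in y.
  have e1 : HasDerivAt (fun z => partialT T u t x z) (partialT T (partialY u) t x y) y :=
    hasDerivAt_partial_swap (f := fun s z => u s x z) (fs := fun s z => partialT T u s x z)
      (g := fun s z => partialY u s x z) (h := fun s z => partialT T (partialY u) s x z)
      (fun s hs z hz => h.regular_u.hasDerivAt_t (hd' s hs x hx z hz.1) hs)
      (fun s hs z hz => h.regular_u.hasDerivAt_y (hd' s hs x hx z hz.1) hz.1)
      (fun s hs => hcw s hs x hx)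
      (fun s hs z hz => h.regular_uy.hasDerivAt_t (hd s hs x hx z hz.1) hs)
      (h.regular_uy.cont_t.comp (f := fun q : ℝ × ℝ => (q.1, x, q.2)) (by fun_prop)
        fun q hq => hd q.1 hq.1 x hx q.2 hq.2.1) ht hy'
  have e2 : HasDerivAt (fun z => partialX L u t x z) (partialX L (partialY u) t x y) y :=
    hasDerivAt_partial_swap (f := fun s z => u t s z) (fs := fun s z => partialX L u t s z)
      (g := fun s z => partialY u t s z) (h := fun s z => partialX L (partialY u) t s z)
      (fun s hs z hz => h.regular_u.hasDerivAt_x (hd' t ht s hs z hz.1) hs)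
      (fun s hs z hz => h.regular_u.hasDerivAt_y (hd' t ht s hs z hz.1) hz.1)
      (fun s hs => hcw t ht s hs)
      (fun s hs z hz => h.regular_uy.hasDerivAt_x (hd t ht s hs z hz.1) hs)
      (h.regular_uy.cont_x.comp (f := fun q : ℝ × ℝ => (t, q.1, q.2)) (by fun_prop)
        fun q hq => hd t ht q.1 hq.1 q.2 hq.2.1) hx hy'
  have e3 := h.regular_u.hasDerivAt_y (hd' t ht x hx y hy) hy
  have e4 := h.regular_u.hasDerivAt_yy (hd' t ht x hx y hy) hy
  have e5 : HasDerivAt (fun z => v t x z) (partialY v t x y) y :=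
    (h.diff_v _ (hd' t ht x hx y hy)).hasDerivWithinAt.hasDerivAt (Ici_mem_nhds hy)
  have e6 := h.regular_uy.hasDerivAt_yy (hd t ht x hx y hy) hy
  have lhs := (e1.fun_add (e3.fun_mul e2)).fun_add (e5.fun_mul e4)
  have rhs := (e6.sub_const (pressureGradient L P t x)).congr_of_eventuallyEq
    (f₁ := fun z => partialT T u t x z + u t x z * partialX L u t x z +
      v t x z * partialY u t x z) (by
        filter_upwards [Ioi_mem_nhds hy] with z hz
        exact h.momentum t ⟨ht.1.le, ht.2⟩ x ⟨hx.1.le, hx.2.le⟩ z (le_of_lt hz))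
  have heq := lhs.unique rhs
  -- The two stretching terms add up to (∂_x u + ∂_y v) ∂_y u and cancel.
  have hdiv := h.incompressible t ⟨ht.1.le, ht.2⟩ x ⟨hx.1.le, hx.2.le⟩ y hy.le
  linear_combination heq - partialY u t x y * hdiv

theorem hasDerivWithinAt_u (h : IsClassicalSolution T L Ue P u₀ u₁ u v) (ht : t ∈ Ico 0 T)
    (hx : x ∈ Icc 0 L) (hy : 0 ≤ y) : HasDerivWithinAt (u t x) (partialY u t x y) (Ici 0) y :=
  (h.regular_u.diff_y (t, x, y) ⟨ht, hx, hy⟩).hasDerivWithinAt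

theorem hasDerivAt_u (h : IsClassicalSolution T L Ue P u₀ u₁ u v) (ht : t ∈ Ico 0 T)
    (hx : x ∈ Icc 0 L) (hy : 0 < y) : HasDerivAt (u t x) (partialY u t x y) y :=
  (h.hasDerivWithinAt_u ht hx hy.le).hasDerivAt (Ici_mem_nhds hy)

theorem continuousOn_u (h : IsClassicalSolution T L Ue P u₀ u₁ u v) (ht : t ∈ Ico 0 T)
    (hx : x ∈ Icc 0 L) : ContinuousOn (u t x) (Ici 0) := fun _ hy =>
  (h.hasDerivWithinAt_u ht hx hy).continuousWithinAt

theorem continuousOn_uy (h : IsClassicalSolution T L Ue P u₀ u₁ u v) (ht : t ∈ Ico 0 T)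
    (hx : x ∈ Icc 0 L) : ContinuousOn (partialY u t x) (Ici 0) :=
  h.regular_u.cont_y.comp (f := fun z => (t, x, z)) (by fun_prop) fun _ hz => ⟨ht, hx, hz⟩

theorem monotoneOn_u (h : IsClassicalSolution T L Ue P u₀ u₁ u v) (ht : t ∈ Ico 0 T)
    (hx : x ∈ Icc 0 L) {b : ℝ} (hw : ∀ y ∈ Ioo 0 b, 0 ≤ partialY u t x y) :
    MonotoneOn (u t x) (Icc 0 b) := by
  refine monotoneOn_of_deriv_nonneg (convex_Icc 0 b)
    ((h.continuousOn_u ht hx).mono Icc_subset_Ici_self) ?_ ?_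
  · rw [interior_Icc]
    exact fun y hy => (h.hasDerivAt_u ht hx hy.1).differentiableAt.differentiableWithinAt
  · rw [interior_Icc]
    exact fun y hy => (h.hasDerivAt_u ht hx hy.1).deriv ▸ hw y hy

theorem u_nonneg (h : IsClassicalSolution T L Ue P u₀ u₁ u v) (ht : t ∈ Ico 0 T)
    (hx : x ∈ Icc 0 L) (hy : 0 ≤ y) (hw : ∀ z ∈ Ioo 0 y, 0 ≤ partialY u t x z) :
    0 ≤ u t x y := by
  rw [← h.wall_u t ht x hx]
  exact h.monotoneOn_u ht hx hw (left_mem_Icc.2 hy) (right_mem_Icc.2 hy) hy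

theorem strictMonoOn_u (h : IsClassicalSolution T L Ue P u₀ u₁ u v) (ht : t ∈ Ico 0 T)
    (hx : x ∈ Icc 0 L) (hw : ∀ y > 0, 0 < partialY u t x y) :
    StrictMonoOn (u t x) (Ici 0) := by
  refine strictMonoOn_of_deriv_pos (convex_Ici 0) (h.continuousOn_u ht hx) ?_
  rw [interior_Ici]
  exact fun y hy => (h.hasDerivAt_u ht hx hy).deriv ▸ hw y hy

theorem u_pos (h : IsClassicalSolution T L Ue P u₀ u₁ u v) (ht : t ∈ Ico 0 T)
    (hx : x ∈ Icc 0 L) (hy : 0 < y) (hw : ∀ y > 0, 0 < partialY u t x y) :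
    0 < u t x y := by
  rw [← h.wall_u t ht x hx]
  exact h.strictMonoOn_u ht hx hw self_mem_Ici hy.le hy

theorem tendsto_u (h : IsClassicalSolution T L Ue P u₀ u₁ u v) (ht : t ∈ Ico 0 T)
    (hx : x ∈ Icc 0 L) : Tendsto (u t x) atTop (𝓝 (Ue t x)) :=
  (h.far_field t ht.2).tendsto_at (x := (t, x)) ⟨⟨ht.1, le_rfl⟩, hx⟩

theorem u_le (h : IsClassicalSolution T L Ue P u₀ u₁ u v) (ht : t ∈ Ico 0 T)
    (hx : x ∈ Icc 0 L) (hy : 0 ≤ y) (hw : ∀ y > 0, 0 < partialY u t x y) :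
    u t x y ≤ Ue t x := by
  refine ge_of_tendsto (h.tendsto_u ht hx) ?_
  filter_upwards [eventually_ge_atTop y] with z hz
  exact (h.strictMonoOn_u ht hx hw).monotoneOn hy (hy.trans hz) hz

theorem integral_uy (h : IsClassicalSolution T L Ue P u₀ u₁ u v) (ht : t ∈ Ico 0 T)
    (hx : x ∈ Icc 0 L) {a b : ℝ} (ha : 0 ≤ a) (hab : a ≤ b) :
    ∫ y in a..b, partialY u t x y = u t x b - u t x a := by
  have hs : Icc a b ⊆ Ici 0 := fun y hy => ha.trans hy.1
  refine intervalIntegral.integral_eq_sub_of_hasDerivAt_of_le hab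
    ((h.continuousOn_u ht hx).mono hs) (fun y hy => h.hasDerivAt_u ht hx (ha.trans_lt hy.1)) ?_
  exact ContinuousOn.intervalIntegrable
    ((uIcc_of_le hab).symm ▸ (h.continuousOn_uy ht hx).mono hs)

/-- The normal velocity grows at most linearly. -/
theorem abs_v_le (h : IsClassicalSolution T L Ue P u₀ u₁ u v) (ht : t ∈ Ico 0 T)
    (hx : x ∈ Icc 0 L) (hy : 0 ≤ y) {M : ℝ} (hM : ∀ y ≥ 0, |partialX L u t x y| ≤ M) :
    |v t x y| ≤ M * y := by
  have h1 := (convex_Ici (0 : ℝ)).norm_image_sub_le_of_norm_hasDerivWithin_le (f := v t x)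
    (f' := partialY v t x) (C := M) (x := 0) (y := y)
    (fun z hz => (h.diff_v (t, x, z) ⟨ht, hx, hz⟩).hasDerivWithinAt)
    (fun z hz => by
      have := h.incompressible t ht x hx z hz
      rw [Real.norm_eq_abs, show partialY v t x z = -partialX L u t x z by linarith, abs_neg]
      exact hM z hz) self_mem_Ici hy
  simpa [h.wall_v t ht x hx, abs_of_nonneg hy] using h1

/-- At the wall the momentum equation reduces to a balance of viscosity and pressure. -/
theorem wall_balance (h : IsClassicalSolution T L Ue P u₀ u₁ u v) (ht : t ∈ Ico 0 T)
    (hx : x ∈ Icc 0 L) : partialY (partialY u) t x 0 = pressureGradient L P t x := by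
  have h1 := h.momentum t ht x hx 0 le_rfl
  have h2 : partialT T u t x 0 = 0 := by
    have : partialT T u t x 0 = derivWithin (fun _ => (0 : ℝ)) (Ico 0 T) t :=
      derivWithin_congr (fun s hs => h.wall_u s hs x hx) (h.wall_u t ht x hx)
    rw [this]; simp
  rw [h.wall_u t ht x hx, h.wall_v t ht x hx, h2] at h1
  linarith

theorem partialY_initial (h : IsClassicalSolution T L Ue P u₀ u₁ u v)
    (hx : x ∈ Icc 0 L) (hy : 0 ≤ y) :
    partialY u 0 x y = derivWithin (fun s => u₀ x s) (Ici 0) y :=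
  derivWithin_congr (fun s hs => h.initial x hx s hs) (h.initial x hx y hy)

theorem partialY_inflow (h : IsClassicalSolution T L Ue P u₀ u₁ u v) (ht : t ∈ Ico 0 T)
    (hy : 0 ≤ y) : partialY u t 0 y = derivWithin (fun s => u₁ t s) (Ici 0) y :=
  derivWithin_congr (fun s hs => h.inflow t ht s hs) (h.inflow t ht y hy)

end IsClassicalSolution

/-! ### Comparison principle for the vorticity. -/

namespace IsClassicalSolution

variable {T L : ℝ} {Ue P u₀ u₁ : ℝ → ℝ → ℝ} {u v : ℝ → ℝ → ℝ → ℝ}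

/-- Comparison of the vorticity with a strict subsolution `ψ (t, y)` of the vorticity equation on
`[0, τ] × [0, L] × [y₁, y₂]`. No condition is needed on the outflow boundary `x = L`. -/
theorem comparison (h : IsClassicalSolution T L Ue P u₀ u₁ u v) {τ y₁ y₂ : ℝ} (hτ : τ < T)
    (hy₁ : 0 < y₁)
    (hu : ∀ t ∈ Icc 0 τ, ∀ x ∈ Icc 0 L, ∀ y ∈ Icc y₁ y₂, 0 ≤ u t x y)
    {ψ ψt ψy ψyy : ℝ → ℝ → ℝ} (hψ : Continuous fun q : ℝ × ℝ => ψ q.1 q.2)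
    (hψt : ∀ t y, HasDerivAt (fun s => ψ s y) (ψt t y) t)
    (hψy : ∀ t y, HasDerivAt (fun z => ψ t z) (ψy t y) y)
    (hψyy : ∀ t y, HasDerivAt (fun z => ψy t z) (ψyy t y) y)
    (hsub : ∀ t ∈ Icc 0 τ, ∀ x ∈ Icc 0 L, ∀ y ∈ Icc y₁ y₂,
      ψt t y + v t x y * ψy t y - ψyy t y < 0)
    (h0 : ∀ x ∈ Icc 0 L, ∀ y ∈ Icc y₁ y₂, ψ 0 y ≤ partialY u 0 x y)
    (hin : ∀ t ∈ Icc 0 τ, ∀ y ∈ Icc y₁ y₂, ψ t y ≤ partialY u t 0 y)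
    (hlo : ∀ t ∈ Icc 0 τ, ∀ x ∈ Icc 0 L, ψ t y₁ ≤ partialY u t x y₁)
    (hhi : ∀ t ∈ Icc 0 τ, ∀ x ∈ Icc 0 L, ψ t y₂ ≤ partialY u t x y₂) :
    ∀ t ∈ Icc 0 τ, ∀ x ∈ Icc 0 L, ∀ y ∈ Icc y₁ y₂, ψ t y ≤ partialY u t x y := by
  have hdom : Icc 0 τ ×ˢ Icc 0 L ×ˢ Icc y₁ y₂ ⊆ domain T L := fun q hq =>
    ⟨⟨hq.1.1, hq.1.2.trans_lt hτ⟩, hq.2.1, hy₁.le.trans hq.2.2.1⟩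
  have hg : ContinuousOn (fun q : ℝ × ℝ × ℝ => partialY u q.1 q.2.1 q.2.2 - ψ q.1 q.2.2)
      (Icc 0 τ ×ˢ Icc 0 L ×ˢ Icc y₁ y₂) :=
    (h.regular_u.cont_y.mono hdom).sub
      (hψ.comp (by fun_prop : Continuous fun q : ℝ × ℝ × ℝ => (q.1, q.2.2))).continuousOn
  have main : ∀ t ∈ Icc 0 τ, ∀ x ∈ Ico 0 L, ∀ y ∈ Icc y₁ y₂, ψ t y ≤ partialY u t x y := by
    intro t ht x hx y hy
    by_contra! hneg
    obtain ⟨M, hM⟩ := (isCompact_Icc.prod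
      (isCompact_Icc.prod isCompact_Icc)).exists_bound_of_continuousOn hg
    have hM0 : 0 ≤ M := (norm_nonneg _).trans (hM (t, x, y) ⟨ht, ⟨hx.1, hx.2.le⟩, hy⟩)
    have hLx : 0 < L - x := sub_pos.2 hx.2
    -- The penalty η / (L - x) takes the place of an outflow condition. This η keeps the penalised
    -- difference negative at the violating point, and δ makes it positive at x = L - δ, so its
    -- minimum avoids that face.
    set η := (ψ t y - partialY u t x y) * (L - x) / 2 with hη
    have hη0 : 0 < η := by have := sub_pos.2 hneg; positivity
    set δ := min ((L - x) / 2) (η / (M + 1)) with hδ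
    have hδ0 : 0 < δ := by positivity
    have hδx : δ ≤ (L - x) / 2 := min_le_left _ _
    have hδη : M + 1 ≤ η / δ := by
      rw [le_div_iff₀ hδ0]
      have := (le_div_iff₀ (by positivity : 0 < M + 1)).1 (min_le_right ((L - x) / 2) (η / (M + 1)))
      linarith
    have hpos : ∀ r ∈ Icc 0 (L - δ), 0 < η / (L - r) := fun r hr =>
      div_pos hη0 (by linarith [hr.2])
    have hbox : Icc 0 τ ×ˢ Icc 0 (L - δ) ×ˢ Icc y₁ y₂ ⊆ Icc 0 τ ×ˢ Icc 0 L ×ˢ Icc y₁ y₂ :=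
      prod_mono Subset.rfl (prod_mono (Icc_subset_Icc le_rfl (by linarith)) Subset.rfl)
    have hG : ContinuousOn (fun q : ℝ × ℝ × ℝ =>
        partialY u q.1 q.2.1 q.2.2 - ψ q.1 q.2.2 + η / (L - q.2.1))
        (Icc 0 τ ×ˢ Icc 0 (L - δ) ×ˢ Icc y₁ y₂) := by
      refine (hg.mono hbox).add (ContinuousOn.div continuousOn_const (by fun_prop) ?_)
      intro q hq
      have := hq.2.1.2
      linarith
    have hp : (t, x, y) ∈ Icc 0 τ ×ˢ Icc 0 (L - δ) ×ˢ Icc y₁ y₂ :=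
      ⟨ht, ⟨hx.1, by linarith⟩, hy⟩
    obtain ⟨⟨t', x', y'⟩, ⟨ht', hx', hy'⟩, hmin⟩ := (isCompact_Icc.prod
      (isCompact_Icc.prod isCompact_Icc)).exists_isMinOn ⟨_, hp⟩ hG
    simp only at ht' hx' hy'
    have hx'L : x' ∈ Icc 0 L := ⟨hx'.1, by linarith [hx'.2]⟩
    have hval : partialY u t' x' y' - ψ t' y' + η / (L - x') < 0 := by
      have h1 : partialY u t' x' y' - ψ t' y' + η / (L - x') ≤
        partialY u t x y - ψ t y + η / (L - x) := hmin hp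
      have h2 : η / (L - x) = (ψ t y - partialY u t x y) / 2 := by
        rw [hη]; field_simp
      linarith
    have hpx' := hpos x' hx'
    have ht0 : 0 < t' := by
      refine lt_of_le_of_ne ht'.1 fun e => ?_
      subst e
      linarith [h0 x' hx'L y' hy']
    have hx0 : 0 < x' := by
      refine lt_of_le_of_ne hx'.1 fun e => ?_
      subst e
      linarith [hin t' ht' y' hy']
    have hx1 : x' < L - δ := by
      refine lt_of_le_of_ne hx'.2 fun e => ?_
      have h1 := hM (t', x', y') ⟨ht', hx'L, hy'⟩
      have h2 := (abs_le.1 (Real.norm_eq_abs _ ▸ h1)).1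
      have h3 : L - x' = δ := by linarith
      rw [h3] at hval
      simp only at h2
      linarith
    have hya : y₁ < y' := by
      refine lt_of_le_of_ne hy'.1 fun e => ?_
      subst e
      linarith [hlo t' ht' x' hx'L]
    have hyb : y' < y₂ := by
      refine lt_of_le_of_ne hy'.2 fun e => ?_
      subst e
      linarith [hhi t' ht' x' hx'L]
    have htT : t' ∈ Ioo 0 T := ⟨ht0, ht'.2.trans_lt hτ⟩
    have hxL : x' ∈ Ioo 0 L := ⟨hx0, by linarith⟩
    have hy0 : 0 < y' := hy₁.trans hya
    have hq : (t', x', y') ∈ openDomain T L := ⟨htT, hxL, hy0⟩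
    have hd := h.regular_uy
    -- The minimum may sit at the final time τ, so only the sign of the time derivative is
    -- available, which is the sign required.
    have c1 : partialT T (partialY u) t' x' y' - ψt t' y' ≤ 0 := by
      have h1 : HasDerivAt (fun s => partialY u s x' y' - ψ s y' + η / (L - x'))
          (partialT T (partialY u) t' x' y' - ψt t' y') t' :=
        ((hd.hasDerivAt_t hq htT).sub (hψt t' y')).add_const _
      exact deriv_nonpos_of_isMinOn_Icc ⟨ht0, ht'.2⟩
        (fun s hs => hmin (show (s, x', y') ∈ _ from ⟨hs, hx', hy'⟩)) h1
    have c2 : partialX L (partialY u) t' x' y' + η / (L - x') ^ 2 = 0 := by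
      have hne : L - x' ≠ 0 := by linarith [hxL.2]
      have h2 : HasDerivAt (fun s => η / (L - s)) (η / (L - x') ^ 2) x' := by
        have h3 : HasDerivAt (fun s => L - s) (-1) x' := by
          simpa using (hasDerivAt_id x').const_sub L
        refine ((hasDerivAt_const x' η).fun_div h3 hne).congr_deriv ?_
        ring
      have h1 : HasDerivAt (fun s => partialY u t' s y' - ψ t' y' + η / (L - s))
          (partialX L (partialY u) t' x' y' + η / (L - x') ^ 2) x' :=
        ((hd.hasDerivAt_x hq hxL).sub_const _).fun_add h2
      refine IsLocalMin.hasDerivAt_eq_zero ?_ h1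
      filter_upwards [Icc_mem_nhds hx0 hx1] with s hs using
        hmin (show (t', s, y') ∈ _ from ⟨ht', hs, hy'⟩)
    have hloc : IsLocalMin (fun s => partialY u t' x' s - ψ t' s + η / (L - x')) y' := by
      filter_upwards [Icc_mem_nhds hya hyb] with s hs using
        hmin (show (t', x', s) ∈ _ from ⟨ht', hx', hs⟩)
    have hderiv : ∀ s > 0, HasDerivAt (fun s => partialY u t' x' s - ψ t' s + η / (L - x'))
        (partialY (partialY u) t' x' s - ψy t' s) s := fun s hs =>
      ((hd.hasDerivAt_y (show (t', x', s) ∈ _ from ⟨htT, hxL, hs⟩) hs).sub (hψy t' s)).add_const _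
    have c3 : partialY (partialY u) t' x' y' - ψy t' y' = 0 :=
      hloc.hasDerivAt_eq_zero (hderiv y' hy0)
    have c4 : 0 ≤ partialY (partialY (partialY u)) t' x' y' - ψyy t' y' := by
      refine second_deriv_nonneg_of_isLocalMin hloc
        (f' := fun s => partialY (partialY u) t' x' s - ψy t' s) ?_
        ((hd.hasDerivAt_yy hq hy0).sub (hψyy t' y'))
      filter_upwards [Ioi_mem_nhds hy0] with s hs using hderiv s hs
    have heq := h.vorticity htT hxL hy0
    have hs := hsub t' ht' x' hx'L y' hy'
    have hu' := hu t' ht' x' hx'L y' hy'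
    -- Since u ≥ 0, the penalty enters tangential transport with the favourable sign; the vorticity
    -- equation at the minimum then contradicts the strict subsolution property.
    have c5 : 0 ≤ u t' x' y' * (η / (L - x') ^ 2) := by positivity
    have c2' : partialX L (partialY u) t' x' y' = -(η / (L - x') ^ 2) := by linarith
    rw [c2', show partialY (partialY u) t' x' y' = ψy t' y' by linarith] at heq
    linarith
  intro t ht x hx y hy
  rcases hx.2.lt_or_eq with hlt | rfl
  · exact main t ht x ⟨hx.1, hlt⟩ y hy
  rcases hx.1.eq_or_lt with rfl | hpos
  · exact hin t ht y hy
  have hc : ContinuousWithinAt (fun s => partialY u t s y) (Ico 0 x) x := by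
    have : ContinuousOn (fun s => partialY u t s y) (Icc 0 x) :=
      h.regular_u.cont_y.comp (f := fun s => (t, s, y)) (by fun_prop)
        fun s hs => hdom (show (t, s, y) ∈ _ from ⟨ht, hs, hy⟩)
    exact (this x hx).mono Ico_subset_Icc_self
  have hcl : x ∈ closure (Ico 0 x) := by rw [closure_Ico hpos.ne]; exact hx
  have hne : (𝓝[Ico 0 x] x).NeBot := mem_closure_iff_nhdsWithin_neBot.1 hcl
  refine ge_of_tendsto hc ?_
  filter_upwards [self_mem_nhdsWithin] with s hs using main t ht s hs y hy

end IsClassicalSolution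

/-! ### Maximum principles and the location of the first zero. -/

namespace IsClassicalSolution

variable {T L : ℝ} {Ue P u₀ u₁ : ℝ → ℝ → ℝ} {u v : ℝ → ℝ → ℝ → ℝ}

theorem uy_initial_pos (h : IsClassicalSolution T L Ue P u₀ u₁ u v)
    (hD : MonotoneData T L u₀ u₁) {x y : ℝ} (hx : x ∈ Icc 0 L) (hy : 0 ≤ y) :
    0 < partialY u 0 x y := by
  rw [h.partialY_initial hx hy]; exact hD.mono_initial x hx y hy

theorem uy_inflow_pos (h : IsClassicalSolution T L Ue P u₀ u₁ u v)
    (hD : MonotoneData T L u₀ u₁) {t y : ℝ} (ht : t ∈ Ico 0 T) (hy : 0 ≤ y) :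
    0 < partialY u t 0 y := by
  rw [h.partialY_inflow ht hy]; exact hD.mono_inflow t ht y hy

/-- Strong maximum principle: a nonnegative vorticity is positive off the wall. -/
theorem uy_pos_of_nonneg (h : IsClassicalSolution T L Ue P u₀ u₁ u v) (hL : 0 < L)
    (hD : MonotoneData T L u₀ u₁) {τ : ℝ} (hτ : τ < T)
    (hw : ∀ t ∈ Icc 0 τ, ∀ x ∈ Icc 0 L, ∀ y ≥ 0, 0 ≤ partialY u t x y) :
    ∀ t ∈ Icc 0 τ, ∀ x ∈ Icc 0 L, ∀ y > 0, 0 < partialY u t x y := by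
  intro t ht x hx y₀ hy₀
  have hT : ∀ s ∈ Icc 0 τ, s ∈ Ico 0 T := fun s hs => ⟨hs.1, hs.2.trans_lt hτ⟩
  have h0T : (0 : ℝ) ∈ Ico 0 T := hT 0 ⟨le_rfl, ht.1.trans ht.2⟩
  -- The strip of half-width y₀/2 around y₀ stays off the wall, where the vorticity equation is not
  -- available.
  set r := y₀ / 2 with hr
  have hr0 : 0 < r := by positivity
  set y₁ := y₀ - r with hy₁
  set y₂ := y₀ + r with hy₂
  have hy₁0 : 0 < y₁ := by rw [hy₁, hr]; linarith
  have hdom : Icc 0 τ ×ˢ Icc 0 L ×ˢ Icc y₁ y₂ ⊆ domain T L := fun q hq =>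
    ⟨hT _ hq.1, hq.2.1, hy₁0.le.trans hq.2.2.1⟩
  obtain ⟨V, hV⟩ := (isCompact_Icc.prod
    (isCompact_Icc.prod isCompact_Icc)).exists_bound_of_continuousOn (h.cont_v.mono hdom)
  have hV0 : 0 ≤ V := (norm_nonneg _).trans
    (hV (t, x, y₀) ⟨ht, hx, by constructor <;> simp only [hy₁, hy₂] <;> linarith⟩)
  obtain ⟨m₁, hm₁, hm₁'⟩ := (isCompact_Icc.prod isCompact_Icc).exists_forall_le'
    (f := fun q : ℝ × ℝ => partialY u 0 q.1 q.2) (s := Icc 0 L ×ˢ Icc y₁ y₂) (a := 0)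
    (h.regular_u.cont_y.comp (f := fun q : ℝ × ℝ => (0, q.1, q.2)) (by fun_prop)
      fun q hq => ⟨h0T, hq.1, hy₁0.le.trans hq.2.1⟩)
    (fun q hq => h.uy_initial_pos hD hq.1 (hy₁0.le.trans hq.2.1))
  obtain ⟨m₂, hm₂, hm₂'⟩ := (isCompact_Icc.prod isCompact_Icc).exists_forall_le'
    (f := fun q : ℝ × ℝ => partialY u q.1 0 q.2) (s := Icc 0 τ ×ˢ Icc y₁ y₂) (a := 0)
    (h.regular_u.cont_y.comp (f := fun q : ℝ × ℝ => (q.1, 0, q.2)) (by fun_prop)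
      fun q hq => ⟨hT _ hq.1, ⟨le_rfl, hL.le⟩, hy₁0.le.trans hq.2.1⟩)
    (fun q hq => h.uy_inflow_pos hD (hT _ hq.1) (hy₁0.le.trans hq.2.1))
  -- The barrier is ε e^{-Kt} q² with q = r² - (y - y₀)². It vanishes at both ends of the strip,
  -- where w ≥ 0 is all that is known, and ε puts it below the initial and inflow vorticity. B
  -- bounds the coefficient of q in the subsolution inequality, and K = (B/(4r))² gives -Kq² + Bq -
  -- 8r² = -(Bq/(4r) - 2r)² - 4r² < 0.
  set ε := min m₁ m₂ / r ^ 4 with hε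
  have hε0 : 0 < ε := by have := lt_min hm₁ hm₂; positivity
  have hεr : ε * r ^ 4 = min m₁ m₂ := by rw [hε]; field_simp
  set B := 4 * V * r + 12 with hB
  set K := (B / (4 * r)) ^ 2 with hK
  let ψ : ℝ → ℝ → ℝ := fun t y => ε * Real.exp (-K * t) * (r ^ 2 - (y - y₀) ^ 2) ^ 2
  let ψt : ℝ → ℝ → ℝ := fun t y => ε * (Real.exp (-K * t) * -K) * (r ^ 2 - (y - y₀) ^ 2) ^ 2
  let ψy : ℝ → ℝ → ℝ := fun t y =>
    ε * Real.exp (-K * t) * (-4 * (y - y₀) * (r ^ 2 - (y - y₀) ^ 2))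
  let ψyy : ℝ → ℝ → ℝ := fun t y =>
    ε * Real.exp (-K * t) * (-4 * (r ^ 2 - (y - y₀) ^ 2) + 8 * (y - y₀) ^ 2)
  have hs : ∀ y : ℝ, HasDerivAt (fun y => y - y₀) 1 y := fun y => (hasDerivAt_id y).sub_const y₀
  have hq : ∀ y : ℝ, HasDerivAt (fun y => r ^ 2 - (y - y₀) ^ 2) (-(2 * (y - y₀))) y := fun y =>
    (((hs y).fun_pow 2).const_sub (r ^ 2)).congr_deriv (by simp)
  have hsq : ∀ y ∈ Icc y₁ y₂, 0 ≤ r ^ 2 - (y - y₀) ^ 2 ∧ |y - y₀| ≤ r := by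
    intro y hy
    have h1 : |y - y₀| ≤ r := abs_le.2
      ⟨by simp only [hy₁] at hy; linarith [hy.1], by simp only [hy₂] at hy; linarith [hy.2]⟩
    exact ⟨sub_nonneg.2 (sq_le_sq' (abs_le.1 h1).1 (abs_le.1 h1).2), h1⟩
  have hψle : ∀ s ∈ Icc 0 τ, ∀ y ∈ Icc y₁ y₂, ψ s y ≤ min m₁ m₂ := by
    intro s hs y hy
    rw [← hεr]
    have h1 : Real.exp (-K * s) ≤ 1 := Real.exp_le_one_iff.2 (by
      have : 0 ≤ K * s := mul_nonneg (by positivity) hs.1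
      linarith)
    have h2 : (r ^ 2 - (y - y₀) ^ 2) ^ 2 ≤ r ^ 4 := by
      rw [show r ^ 4 = (r ^ 2) ^ 2 by ring]
      exact pow_le_pow_left₀ (hsq y hy).1 (by nlinarith [sq_nonneg (y - y₀)]) 2
    calc ψ s y ≤ ε * 1 * r ^ 4 := by simp only [ψ]; gcongr
      _ = ε * r ^ 4 := by ring
  have hcmp := h.comparison hτ hy₁0 (y₂ := y₂) (ψ := ψ) (ψt := ψt) (ψy := ψy) (ψyy := ψyy)
    (fun s hs x hx y hy => h.u_nonneg (hT s hs) hx (hy₁0.le.trans hy.1)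
      fun z hz => hw s hs x hx z hz.1.le)
    (by simp only [ψ]; fun_prop)
    (fun s y => by
      have h1 : HasDerivAt (fun s => -K * s) (-K) s := by
        simpa using (hasDerivAt_id s).const_mul (-K)
      exact (h1.exp.const_mul ε).mul_const _)
    (fun s y => by
      refine (((hq y).fun_pow 2).const_mul (ε * Real.exp (-K * s))).congr_deriv ?_
      simp only [ψy]; push_cast; ring)
    (fun s y => by
      refine ((((hs y).const_mul (-4)).fun_mul (hq y)).const_mul
        (ε * Real.exp (-K * s))).congr_deriv ?_
      simp only [ψyy]; ring)
    (fun s hs x hx y hy => by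
      obtain ⟨hq0, hsr⟩ := hsq y hy
      have hv := hV (s, x, y) ⟨hs, hx, hy⟩
      rw [Real.norm_eq_abs] at hv
      set q := r ^ 2 - (y - y₀) ^ 2 with hqdef
      have e : ψt s y + v s x y * ψy s y - ψyy s y =
          ε * Real.exp (-K * s) * (-K * q ^ 2 - 4 * (v s x y * (y - y₀)) * q + 12 * q - 8 * r ^ 2) := by
        simp only [ψt, ψy, ψyy, ← hqdef]
        rw [show (y - y₀) ^ 2 = r ^ 2 - q by rw [hqdef]; ring]
        ring
      rw [e]
      refine mul_neg_of_pos_of_neg (by positivity) ?_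
      have h1 : |v s x y * (y - y₀)| ≤ V * r := by
        rw [abs_mul]; exact mul_le_mul hv hsr (abs_nonneg _) hV0
      have h2 : -4 * (v s x y * (y - y₀)) * q ≤ 4 * (V * r) * q := by
        have := (abs_le.1 h1).1
        nlinarith
      have h3 : -K * q ^ 2 + B * q - 8 * r ^ 2 = -(B / (4 * r) * q - 2 * r) ^ 2 - 4 * r ^ 2 := by
        rw [hK]; field_simp; ring
      have h4 : 0 < r ^ 2 := by positivity
      have h5 : B * q = 4 * (V * r) * q + 12 * q := by rw [hB]; ring
      nlinarith [sq_nonneg (B / (4 * r) * q - 2 * r)])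
    (fun x hx y hy => (hψle 0 ⟨le_rfl, ht.1.trans ht.2⟩ y hy).trans
      ((min_le_left _ _).trans (hm₁' (x, y) ⟨hx, hy⟩)))
    (fun s hs y hy => (hψle s hs y hy).trans
      ((min_le_right _ _).trans (hm₂' (s, y) ⟨hs, hy⟩)))
    (fun s hs x hx => by
      have : ψ s y₁ = 0 := by simp only [ψ, hy₁]; ring
      rw [this]; exact hw s hs x hx y₁ hy₁0.le)
    (fun s hs x hx => by
      have : ψ s y₂ = 0 := by simp only [ψ, hy₂]; ring
      rw [this]; exact hw s hs x hx y₂ (by simp only [hy₂]; linarith))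
  refine lt_of_lt_of_le ?_ (hcmp t ht x hx y₀ (by constructor <;> simp only [hy₁, hy₂] <;> linarith))
  have : ψ t y₀ = ε * Real.exp (-K * t) * r ^ 4 := by simp only [ψ, sub_self]; ring
  rw [this]
  positivity

/-- Maximum principle in the unbounded region `y ≥ Y` where the flow is nonnegative. -/
theorem uy_nonneg_of_far (h : IsClassicalSolution T L Ue P u₀ u₁ u v)
    (hD : MonotoneData T L u₀ u₁) {τ Y : ℝ} (hτ : τ < T) (hY : 0 < Y)
    (hu : ∀ t ∈ Icc 0 τ, ∀ x ∈ Icc 0 L, ∀ y ≥ Y, 0 ≤ u t x y)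
    (hwY : ∀ t ∈ Icc 0 τ, ∀ x ∈ Icc 0 L, 0 ≤ partialY u t x Y) :
    ∀ t ∈ Icc 0 τ, ∀ x ∈ Icc 0 L, ∀ y ≥ Y, 0 ≤ partialY u t x y := by
  intro t ht x hx y hy
  have hT : ∀ s ∈ Icc 0 τ, s ∈ Ico 0 T := fun s hs => ⟨hs.1, hs.2.trans_lt hτ⟩
  obtain ⟨M, hM⟩ := h.bounded τ hτ
  have hM0 : 0 ≤ M := (abs_nonneg _).trans (hM t ht x hx y (hY.le.trans hy)).1
  -- The barrier is -η e^{Kt}(1 + y²) with η → 0. As |v| ≤ My, the drift costs at most 2My² and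
  -- diffusion 2, both absorbed by K(1 + y²).
  set K := 2 * M + 3 with hK
  suffices H : ∀ η > 0, -(η * Real.exp (K * t) * (1 + y ^ 2)) ≤ partialY u t x y by
    by_contra! hneg
    set c := Real.exp (K * t) * (1 + y ^ 2) with hc
    have hc0 : 0 < c := by positivity
    have h1 := H (-partialY u t x y / (2 * c)) (div_pos (by linarith) (by positivity))
    rw [mul_assoc, ← hc] at h1
    have h2 : -partialY u t x y / (2 * c) * c = -partialY u t x y / 2 := by field_simp
    rw [h2] at h1
    linarith
  intro η hη
  -- The top of the box is so high that the barrier lies below -M, hence below ∂_y u, there.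
  set Y' := y + M / η + 1 with hY'
  have hMη : 0 ≤ M / η := by positivity
  have hYM : M ≤ η * (1 + Y' ^ 2) := by
    have h1 : M = η * (M / η) := by field_simp
    have h2 : M / η ≤ 1 + Y' ^ 2 := by nlinarith
    calc M = η * (M / η) := h1
      _ ≤ _ := by gcongr
  have hq : ∀ y : ℝ, HasDerivAt (fun y => 1 + y ^ 2) (2 * y) y := fun y =>
    (((hasDerivAt_id y).fun_pow 2).const_add 1).congr_deriv (by simp)
  have hneg : ∀ s y : ℝ, -(η * Real.exp (K * s) * (1 + y ^ 2)) ≤ 0 := fun s y => by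
    have : 0 ≤ η * Real.exp (K * s) * (1 + y ^ 2) := by positivity
    linarith
  have hcmp := h.comparison hτ hY (y₂ := Y')
    (ψ := fun s y => -(η * Real.exp (K * s) * (1 + y ^ 2)))
    (ψt := fun s y => -(η * (Real.exp (K * s) * K) * (1 + y ^ 2)))
    (ψy := fun s y => -(η * Real.exp (K * s) * (2 * y)))
    (ψyy := fun s y => -(η * Real.exp (K * s) * (2 * 1)))
    (fun s hs x hx y hy => hu s hs x hx y hy.1)
    (by fun_prop)
    (fun s y => by
      have h1 : HasDerivAt (fun s => K * s) K s := by
        simpa using (hasDerivAt_id s).const_mul K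
      exact ((h1.exp.const_mul η).mul_const _).fun_neg)
    (fun s y => ((hq y).const_mul _).fun_neg)
    (fun s y => (((hasDerivAt_id y).const_mul 2).const_mul _).fun_neg)
    (fun s hs x hx y hy => by
      have hy0 : 0 ≤ y := hY.le.trans hy.1
      have hv := h.abs_v_le (hT s hs) hx hy0 (fun z hz => (hM s hs x hx z hz).1)
      have h1 := (abs_le.1 hv).1
      have e : -(η * (Real.exp (K * s) * K) * (1 + y ^ 2)) +
          v s x y * -(η * Real.exp (K * s) * (2 * y)) - -(η * Real.exp (K * s) * (2 * 1)) =
          η * Real.exp (K * s) * -(K * (1 + y ^ 2) + 2 * (v s x y * y) - 2) := by ring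
      rw [e]
      refine mul_neg_of_pos_of_neg (by positivity) ?_
      have h2 : -(M * y) * y ≤ v s x y * y := mul_le_mul_of_nonneg_right h1 hy0
      rw [hK]
      nlinarith [sq_nonneg y])
    (fun x hx y hy => (hneg 0 y).trans (h.uy_initial_pos hD hx (hY.le.trans hy.1)).le)
    (fun s hs y hy => (hneg s y).trans (h.uy_inflow_pos hD (hT s hs) (hY.le.trans hy.1)).le)
    (fun s hs x hx => (hneg s Y).trans (hwY s hs x hx))
    (fun s hs x hx => by
      have h1 := (abs_le.1 (hM s hs x hx Y' (by rw [hY']; linarith)).2).1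
      have h2 : 1 ≤ Real.exp (K * s) := Real.one_le_exp (mul_nonneg (by positivity) hs.1)
      have h3 : η * 1 * (1 + Y' ^ 2) ≤ η * Real.exp (K * s) * (1 + Y' ^ 2) := by gcongr
      linarith)
  exact hcmp t ht x hx y ⟨hy, by rw [hY']; linarith⟩

/-- For large `y` the velocity is positive, locally uniformly in time. -/
theorem exists_u_pos_far (h : IsClassicalSolution T L Ue P u₀ u₁ u v)
    (hUe : ContinuousOn (fun q : ℝ × ℝ => Ue q.1 q.2) (Icc 0 T ×ˢ Icc 0 L))
    (hUe_pos : ∀ t ∈ Icc 0 T, ∀ x ∈ Icc 0 L, 0 < Ue t x) {τ : ℝ} (hτ : τ < T) :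
    ∃ Y > 0, ∀ t ∈ Icc 0 τ, ∀ x ∈ Icc 0 L, ∀ y ≥ Y, 0 < u t x y := by
  obtain ⟨m, hm, hm'⟩ := (isCompact_Icc.prod isCompact_Icc).exists_forall_le'
    (f := fun q : ℝ × ℝ => Ue q.1 q.2) (a := 0) hUe (fun q hq => hUe_pos q.1 hq.1 q.2 hq.2)
  have h1 := Metric.tendstoUniformlyOn_iff.1 (h.far_field τ hτ) m hm
  obtain ⟨Y, hY⟩ := eventually_atTop.1 h1
  refine ⟨max Y 1, by positivity, fun t ht x hx y hy => ?_⟩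
  have h2 := hY y ((le_max_left _ _).trans hy) (t, x) ⟨ht, hx⟩
  have h3 := hm' (t, x) ⟨⟨ht.1, ht.2.trans hτ.le⟩, hx⟩
  rw [Real.dist_eq] at h2
  have := (abs_lt.1 h2).2
  simp only at this h3
  linarith

theorem uy_nonneg_of_pos_before (h : IsClassicalSolution T L Ue P u₀ u₁ u v) {t x y : ℝ}
    (ht : t ∈ Ioo 0 T) (hx : x ∈ Icc 0 L) (hy : 0 ≤ y)
    (hw : ∀ s ∈ Ico 0 t, 0 < partialY u s x y) : 0 ≤ partialY u t x y := by
  have hc : ContinuousWithinAt (fun s => partialY u s x y) (Ico 0 t) t := by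
    have : ContinuousOn (fun s => partialY u s x y) (Ico 0 T) :=
      h.regular_u.cont_y.comp (f := fun s => (s, x, y)) (by fun_prop)
        fun s hs => ⟨hs, hx, hy⟩
    exact (this t ⟨ht.1.le, ht.2⟩).mono (Ico_subset_Ico_right ht.2.le)
  have hcl : t ∈ closure (Ico 0 t) := by rw [closure_Ico ht.1.ne]; exact ⟨ht.1.le, le_rfl⟩
  have hne : (𝓝[Ico 0 t] t).NeBot := mem_closure_iff_nhdsWithin_neBot.1 hcl
  refine ge_of_tendsto hc ?_
  filter_upwards [self_mem_nhdsWithin] with s hs using (hw s hs).le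

/-- The vorticity stays positive as long as it is positive on the wall. -/
theorem uy_pos_of_wall_pos (h : IsClassicalSolution T L Ue P u₀ u₁ u v) (hL : 0 < L)
    (hD : MonotoneData T L u₀ u₁)
    (hUe : ContinuousOn (fun q : ℝ × ℝ => Ue q.1 q.2) (Icc 0 T ×ˢ Icc 0 L))
    (hUe_pos : ∀ t ∈ Icc 0 T, ∀ x ∈ Icc 0 L, 0 < Ue t x) {τ : ℝ} (hτ0 : 0 ≤ τ) (hτ : τ < T)
    (hwall : ∀ t ∈ Icc 0 τ, ∀ x ∈ Icc 0 L, 0 < partialY u t x 0) :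
    ∀ t ∈ Icc 0 τ, ∀ x ∈ Icc 0 L, ∀ y ≥ 0, 0 < partialY u t x y := by
  let S : Set ℝ := {s | ∀ t ∈ Icc 0 s, ∀ x ∈ Icc 0 L, ∀ y ≥ 0, 0 < partialY u t x y}
  have hself : ∀ s ∈ Icc 0 τ,
      (∀ t ∈ Icc 0 s, ∀ x ∈ Icc 0 L, ∀ y ≥ 0, 0 ≤ partialY u t x y) → s ∈ S := by
    intro s hs hw t ht x hx y hy
    rcases hy.eq_or_lt with rfl | hy
    · exact hwall t ⟨ht.1, ht.2.trans hs.2⟩ x hx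
    · exact h.uy_pos_of_nonneg hL hD (hs.2.trans_lt hτ) hw t ht x hx y hy
  suffices H : Icc 0 τ ⊆ S from H (right_mem_Icc.2 hτ0)
  -- Continuation in time. S is closed in [0, τ] because a limit of positive vorticities is
  -- nonnegative, and then positive by the wall hypothesis and the strong maximum principle. It
  -- extends to the right because positivity persists on the compact part y ≤ Y, while the far-field
  -- principle covers y ≥ Y.
  refine IsClosed.Icc_subset_of_forall_exists_gt ?_ ?_ ?_
  · refine isClosed_of_closure_subset fun s hs => ?_
    have hsτ : s ∈ Icc 0 τ := by
      have := closure_mono (inter_subset_right (s := S)) hs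
      rwa [isClosed_Icc.closure_eq] at this
    have hlt : ∀ t ∈ Ico 0 s, ∀ x ∈ Icc 0 L, ∀ y ≥ 0, 0 < partialY u t x y := by
      intro t ht
      obtain ⟨s', hs', hts'⟩ : ∃ s' ∈ S ∩ Icc 0 τ, t < s' := by
        obtain ⟨s', h1, h2⟩ := mem_closure_iff.1 hs (Ioi t) isOpen_Ioi ht.2
        exact ⟨s', h2, h1⟩
      exact hs'.1 t ⟨ht.1, hts'.le⟩
    refine ⟨hself s hsτ fun t ht x hx y hy => ?_, hsτ⟩
    rcases ht.2.lt_or_eq with hlt' | rfl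
    · exact (hlt t ⟨ht.1, hlt'⟩ x hx y hy).le
    · rcases ht.1.eq_or_lt with rfl | h0
      · exact (h.uy_initial_pos hD hx hy).le
      · exact h.uy_nonneg_of_pos_before ⟨h0, hsτ.2.trans_lt hτ⟩ hx hy
          fun s hs => hlt s hs x hx y hy
  · intro t ht x hx y hy
    have : t = 0 := le_antisymm ht.2 ht.1
    exact this ▸ h.uy_initial_pos hD hx hy
  · rintro s ⟨hsS, hs⟩ z hz
    obtain ⟨Y, hY0, hY⟩ := h.exists_u_pos_far hUe hUe_pos hτ
    have hev : ∀ᶠ t in 𝓝 s, ∀ q ∈ Icc 0 L ×ˢ Icc 0 Y,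
        t ∈ Ico 0 T → 0 < partialY u t q.1 q.2 := by
      refine (isCompact_Icc.prod isCompact_Icc).eventually_forall_of_forall_eventually
        (P := fun t (q : ℝ × ℝ) => q ∈ Icc 0 L ×ˢ Icc 0 Y → t ∈ Ico 0 T → 0 < partialY u t q.1 q.2)
        ?_ |>.mono fun t ht q hq => ht q hq hq
      intro q hq
      have hc := h.regular_u.cont_y (s, q) ⟨⟨hs.1, hs.2.trans hτ⟩, hq.1, hq.2.1⟩
      have := hc.eventually (lt_mem_nhds (hsS s ⟨hs.1, le_rfl⟩ q.1 hq.1 q.2 hq.2.1))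
      filter_upwards [eventually_nhdsWithin_iff.1 this] with p hp hp1 hp2
      exact hp ⟨hp2, hp1.1, hp1.2.1⟩
    obtain ⟨b, hsb, hb⟩ := (nhdsGE_basis s).mem_iff.1 (mem_nhdsWithin_of_mem_nhds hev)
    obtain ⟨s', hs1, hs2⟩ := exists_between (lt_min (lt_min hs.2 hz) hsb)
    have hs'τ : s' < τ := hs2.trans_le ((min_le_left _ _).trans (min_le_left _ _))
    have hs'z : s' < z := hs2.trans_le ((min_le_left _ _).trans (min_le_right _ _))
    have hs'b : s' < b := hs2.trans_le (min_le_right _ _)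
    have hnear : ∀ t ∈ Icc 0 s', ∀ x ∈ Icc 0 L, ∀ y ∈ Icc 0 Y, 0 < partialY u t x y := by
      intro t ht x hx y hy
      rcases le_total t s with hts | hts
      · exact hsS t ⟨ht.1, hts⟩ x hx y hy.1
      · exact hb ⟨hts, ht.2.trans_lt hs'b⟩ (x, y) ⟨hx, hy⟩
          ⟨ht.1, (ht.2.trans_lt hs'τ).trans hτ⟩
    have hfar := h.uy_nonneg_of_far hD (hs'τ.trans hτ) hY0
      (fun t ht x hx y hy => (hY t ⟨ht.1, ht.2.trans hs'τ.le⟩ x hx y hy).le)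
      (fun t ht x hx => (hnear t ht x hx Y ⟨hY0.le, le_rfl⟩).le)
    refine ⟨s', hself s' ⟨hs.1.trans hs1.le, hs'τ.le⟩ fun t ht x hx y hy => ?_, hs1, hs'z.le⟩
    rcases le_total y Y with hyY | hyY
    · exact (hnear t ht x hx y ⟨hy, hyY⟩).le
    · exact hfar t ht x hx y hyY

/-- Up to the first zero the vorticity is positive. -/
theorem uy_pos_of_ne_zero (h : IsClassicalSolution T L Ue P u₀ u₁ u v)
    (hD : MonotoneData T L u₀ u₁) {t x y : ℝ} (ht : t ∈ Ico 0 T) (hx : x ∈ Icc 0 L) (hy : 0 ≤ y)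
    (hne : ∀ s ∈ Icc 0 t, partialY u s x y ≠ 0) : 0 < partialY u t x y := by
  by_contra! hle
  have hc : ContinuousOn (fun s => partialY u s x y) (Icc 0 t) :=
    h.regular_u.cont_y.comp (f := fun s => (s, x, y)) (by fun_prop)
      fun s hs => ⟨⟨hs.1, hs.2.trans_lt ht.2⟩, hx, hy⟩
  obtain ⟨s, hs, h0⟩ := intermediate_value_Icc' ht.1 hc ⟨hle, (h.uy_initial_pos hD hx hy).le⟩
  exact hne s hs h0

/-- The vorticity is positive before t₀, hence nonnegative up to and including t₀, and the strong
maximum principle then excludes a zero off the wall. -/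
theorem firstCriticalPoint_on_wall (h : IsClassicalSolution T L Ue P u₀ u₁ u v) (hL : 0 < L)
    (hD : MonotoneData T L u₀ u₁) {t₀ x₀ y₀ : ℝ} (hc : IsFirstCriticalPoint T L u t₀ x₀ y₀) :
    y₀ = 0 := by
  by_contra hy
  have hpos : ∀ t ∈ Ico 0 t₀, ∀ x ∈ Icc 0 L, ∀ y ≥ 0, 0 < partialY u t x y :=
    fun t ht x hx y hy => h.uy_pos_of_ne_zero hD ⟨ht.1, ht.2.trans hc.mem_t.2⟩ hx hy
      fun s hs => hc.first s ⟨hs.1, hs.2.trans_lt ht.2⟩ x hx y hy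
  have hnn : ∀ t ∈ Icc 0 t₀, ∀ x ∈ Icc 0 L, ∀ y ≥ 0, 0 ≤ partialY u t x y := by
    intro t ht x hx y hy
    rcases ht.2.lt_or_eq with hlt | rfl
    · exact (hpos t ⟨ht.1, hlt⟩ x hx y hy).le
    · exact h.uy_nonneg_of_pos_before hc.mem_t hx hy fun s hs => hpos s hs x hx y hy
  have := h.uy_pos_of_nonneg hL hD hc.mem_t.2 hnn t₀ ⟨hc.mem_t.1.le, le_rfl⟩ x₀ hc.mem_x y₀
    (lt_of_le_of_ne hc.mem_y (Ne.symm hy))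
  exact this.ne' hc.zero

/-- The layer is unbounded in y, so t₀ is taken as the earliest time at which ∂_y u ≤ 0 somewhere on
the wall, a minimisation over a compact set. `uy_pos_of_wall_pos` shows both that this set is
nonempty and that nothing vanishes before t₀. -/
theorem exists_firstCriticalPoint (h : IsClassicalSolution T L Ue P u₀ u₁ u v) (hL : 0 < L)
    (hD : MonotoneData T L u₀ u₁)
    (hUe : ContinuousOn (fun q : ℝ × ℝ => Ue q.1 q.2) (Icc 0 T ×ˢ Icc 0 L))
    (hUe_pos : ∀ t ∈ Icc 0 T, ∀ x ∈ Icc 0 L, 0 < Ue t x)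
    (hz : ∃ t ∈ Ioo 0 T, ∃ x ∈ Icc 0 L, ∃ y ≥ 0, partialY u t x y = 0) :
    ∃ t₀ x₀, IsFirstCriticalPoint T L u t₀ x₀ 0 := by
  obtain ⟨t₁, ht₁, x₁, hx₁, y₁, hy₁, hz⟩ := hz
  have hc : ContinuousOn (fun q : ℝ × ℝ => partialY u q.1 q.2 0) (Icc 0 t₁ ×ˢ Icc 0 L) :=
    h.regular_u.cont_y.comp (f := fun q : ℝ × ℝ => (q.1, q.2, 0)) (by fun_prop)
      fun q hq => ⟨⟨hq.1.1, hq.1.2.trans_lt ht₁.2⟩, hq.2, self_mem_Ici⟩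
  set S := (Icc 0 t₁ ×ˢ Icc 0 L) ∩ (fun q : ℝ × ℝ => partialY u q.1 q.2 0) ⁻¹' Iic 0 with hS
  have hScomp : IsCompact S := (isCompact_Icc.prod isCompact_Icc).of_isClosed_subset
    (hc.preimage_isClosed_of_isClosed (isClosed_Icc.prod isClosed_Icc) isClosed_Iic)
    inter_subset_left
  have hSne : S.Nonempty := by
    by_contra hemp
    rw [not_nonempty_iff_eq_empty] at hemp
    have := h.uy_pos_of_wall_pos hL hD hUe hUe_pos ht₁.1.le ht₁.2
      (fun t ht x hx => by
        by_contra! hle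
        have : (t, x) ∈ S := ⟨⟨ht, hx⟩, hle⟩
        rw [hemp] at this
        exact this) t₁ ⟨ht₁.1.le, le_rfl⟩ x₁ hx₁ y₁ hy₁
    exact this.ne' hz
  obtain ⟨⟨t₀, x₀⟩, ⟨⟨ht₀, hx₀⟩, hle⟩, hmin⟩ :=
    hScomp.exists_isMinOn hSne (f := fun q : ℝ × ℝ => q.1) (by fun_prop)
  simp only at ht₀ hx₀
  simp only [mem_preimage, mem_Iic] at hle
  have ht₀0 : 0 < t₀ := by
    refine lt_of_le_of_ne ht₀.1 fun e => ?_
    subst e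
    linarith [h.uy_initial_pos hD hx₀ le_rfl]
  have ht₀T : t₀ ∈ Ioo 0 T := ⟨ht₀0, ht₀.2.trans_lt ht₁.2⟩
  have hpos : ∀ t ∈ Ico 0 t₀, ∀ x ∈ Icc 0 L, ∀ y ≥ 0, 0 < partialY u t x y := by
    intro t ht
    refine h.uy_pos_of_wall_pos hL hD hUe hUe_pos ht.1 (ht.2.trans ht₀T.2) ?_ t ⟨ht.1, le_rfl⟩
    intro s hs x hx
    by_contra! hle'
    have h1 : t₀ ≤ s := hmin (show (s, x) ∈ S from
      ⟨⟨⟨hs.1, hs.2.trans (ht.2.le.trans ht₀.2)⟩, hx⟩, hle'⟩)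
    linarith [hs.2, ht.2]
  refine ⟨t₀, x₀, ht₀T, hx₀, le_rfl, le_antisymm hle ?_, fun t ht x hx y hy =>
    (hpos t ht x hx y hy).ne'⟩
  exact h.uy_nonneg_of_pos_before ht₀T hx₀ le_rfl fun s hs => hpos s hs x₀ hx₀ 0 le_rfl

end IsClassicalSolution

/-! ### Algebra of the quotient b / √(b² + a²) and the cutoff. -/

/-- The quotient `b / √(b² + a²)`, to be used with `a = u` and `b = ∂_y u`. -/
noncomputable def angle (a b : ℝ) : ℝ := b / √(b ^ 2 + a ^ 2)

/-- The derivative of `angle a b` along a curve with velocity `(a', b')`. -/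
noncomputable def angleDeriv (a b a' b' : ℝ) : ℝ := a * (a * b' - b * a') / √(b ^ 2 + a ^ 2) ^ 3

/-- The second derivative of `angle a a'`. -/
noncomputable def angleDeriv2 (a b c d : ℝ) : ℝ :=
  (a ^ 2 * d - b ^ 3) / √(b ^ 2 + a ^ 2) ^ 3 -
    3 * (a * (a * c - b * b)) * (b * (a + c)) / √(b ^ 2 + a ^ 2) ^ 5

theorem sqrt_sq_add_sq_pos (a : ℝ) {b : ℝ} (hb : 0 < b) : 0 < √(b ^ 2 + a ^ 2) :=
  Real.sqrt_pos.2 (by positivity)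

theorem angle_nonneg (a : ℝ) {b : ℝ} (hb : 0 ≤ b) : 0 ≤ angle a b := by
  unfold angle; positivity

theorem angle_le_one (a : ℝ) {b : ℝ} (hb : 0 < b) : angle a b ≤ 1 := by
  rw [angle, div_le_one (sqrt_sq_add_sq_pos a hb)]
  exact Real.le_sqrt_of_sq_le (by nlinarith [sq_nonneg a])

/-- With a = u and b = ∂_y u, this controls the tangential flux by the vorticity, whose integral
across the layer is at most U_e. It also makes the quotient integrable where u is bounded below. -/
theorem mul_angle_le (a : ℝ) {b : ℝ} (hb : 0 < b) : a * angle a b ≤ b := by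
  have h := sqrt_sq_add_sq_pos a hb
  rw [angle, mul_div_assoc', div_le_iff₀ h, mul_comm]
  exact mul_le_mul_of_nonneg_left (Real.le_sqrt_of_sq_le (by nlinarith [sq_nonneg b])) hb.le

theorem hasDerivAt_sqrt_sq_add_sq {a b : ℝ → ℝ} {a' b' s : ℝ} (ha : HasDerivAt a a' s)
    (hb : HasDerivAt b b' s) (hpos : 0 < b s) :
    HasDerivAt (fun s => √(b s ^ 2 + a s ^ 2))
      ((a s * a' + b s * b') / √(b s ^ 2 + a s ^ 2)) s := by
  have h := sqrt_sq_add_sq_pos (a s) hpos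
  refine (((hb.fun_pow 2).fun_add (ha.fun_pow 2)).sqrt (by positivity)).congr_deriv ?_
  field_simp
  push_cast
  ring

theorem hasDerivAt_angle {a b : ℝ → ℝ} {a' b' s : ℝ} (ha : HasDerivAt a a' s)
    (hb : HasDerivAt b b' s) (hpos : 0 < b s) :
    HasDerivAt (fun s => angle (a s) (b s)) (angleDeriv (a s) (b s) a' b') s := by
  have h := sqrt_sq_add_sq_pos (a s) hpos
  have h2 : √(b s ^ 2 + a s ^ 2) ^ 2 = b s ^ 2 + a s ^ 2 := Real.sq_sqrt (by positivity)
  refine (hb.fun_div (hasDerivAt_sqrt_sq_add_sq ha hb hpos) h.ne').congr_deriv ?_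
  rw [angleDeriv]
  generalize √(b s ^ 2 + a s ^ 2) = ρ at *
  field_simp
  rw [h2]
  ring

theorem hasDerivAt_angleDeriv {a b c : ℝ → ℝ} {d s : ℝ} (ha : HasDerivAt a (b s) s)
    (hb : HasDerivAt b (c s) s) (hc : HasDerivAt c d s) (hpos : 0 < b s) :
    HasDerivAt (fun s => angleDeriv (a s) (b s) (b s) (c s))
      (angleDeriv2 (a s) (b s) (c s) d) s := by
  have h := sqrt_sq_add_sq_pos (a s) hpos
  have h2 : √(b s ^ 2 + a s ^ 2) ^ 2 = b s ^ 2 + a s ^ 2 := Real.sq_sqrt (by positivity)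
  refine ((ha.fun_mul ((ha.fun_mul hc).fun_sub (hb.fun_mul hb))).fun_div
    ((hasDerivAt_sqrt_sq_add_sq ha hb hpos).fun_pow 3) (by positivity)).congr_deriv ?_
  rw [angleDeriv2]
  generalize √(b s ^ 2 + a s ^ 2) = ρ at *
  field_simp
  push_cast
  ring

/-- The pointwise inequality behind the monotonicity of the weighted integral of `angle`. -/
theorem angleDeriv2_le {a b c d p : ℝ} (hb : 0 < b) :
    angleDeriv2 a b c d + p * (a * b / √(b ^ 2 + a ^ 2) ^ 3) - angle a b / 3 ≤
      a * (a * d - b * (c - p)) / √(b ^ 2 + a ^ 2) ^ 3 := by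
  have h := sqrt_sq_add_sq_pos a hb
  have h2 : √(b ^ 2 + a ^ 2) ^ 2 = b ^ 2 + a ^ 2 := Real.sq_sqrt (by positivity)
  rw [angleDeriv2, angle]
  generalize √(b ^ 2 + a ^ 2) = ρ at *
  have e : a * (a * d - b * (c - p)) / ρ ^ 3 - ((a ^ 2 * d - b ^ 3) / ρ ^ 3 -
      3 * (a * (a * c - b * b)) * (b * (a + c)) / ρ ^ 5 + p * (a * b / ρ ^ 3) - b / ρ / 3) =
      b * (3 * ((b ^ 2 - a * c) * ρ ^ 2 + 3 * a * (a * c - b ^ 2) * (a + c)) + (ρ ^ 2) ^ 2)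
        / (3 * ρ ^ 5) := by
    field_simp
    ring
  rw [← sub_nonneg, e, h2]
  refine div_nonneg (mul_nonneg hb.le ?_) (by positivity)
  -- The bracket is exactly this square; the contribution of `angle a b / 3` is what completes it.
  nlinarith [sq_nonneg (3 * (a * c) + (a ^ 2 - 2 * b ^ 2))]

/-- A form of Young's inequality. -/
theorem angle_young {a b lam : ℝ} (ha : 0 < a) (hb : 0 < b) (hl : 0 ≤ lam) :
    3 * lam ^ 2 * angle a b - 2 * lam ^ 3 * (b / √a) ≤ a * b / √(b ^ 2 + a ^ 2) ^ 3 := by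
  have h := sqrt_sq_add_sq_pos a hb
  rw [angle]
  generalize √(b ^ 2 + a ^ 2) = ρ at *
  have hs : 0 < √a := Real.sqrt_pos.2 ha
  have ha2 : a = √a ^ 2 := (Real.sq_sqrt ha.le).symm
  generalize √a = s at *
  subst ha2
  -- This is the tangent-line inequality r³ ≥ 3λ²r - 2λ³ at r = √a/ρ, multiplied by b/√a.
  have e : s ^ 2 * b / ρ ^ 3 - (3 * lam ^ 2 * (b / ρ) - 2 * lam ^ 3 * (b / s)) =
      b * ((s - lam * ρ) ^ 2 * (s + 2 * (lam * ρ))) / (ρ ^ 3 * s) := by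
    field_simp
    ring
  rw [← sub_nonneg, e]
  positivity

/-- The cutoff in the normal direction. -/
noncomputable def cutoff (N y : ℝ) : ℝ := (1 - y / N) ^ 2

theorem hasDerivAt_cutoff (N y : ℝ) : HasDerivAt (cutoff N) (-(2 / N) * (1 - y / N)) y := by
  have h1 : HasDerivAt (fun y => 1 - y / N) (-(1 / N)) y :=
    ((hasDerivAt_id y).div_const N).const_sub 1
  refine (h1.fun_pow 2).congr_deriv ?_
  push_cast
  ring

/-- The second derivative is nonnegative, so the term it produces on integrating the diffusion by
parts twice can be dropped. -/
theorem hasDerivAt_cutoff_deriv (N y : ℝ) :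
    HasDerivAt (fun y => -(2 / N) * (1 - y / N)) (2 / N ^ 2) y := by
  have h1 : HasDerivAt (fun y => 1 - y / N) (-(1 / N)) y :=
    ((hasDerivAt_id y).div_const N).const_sub 1
  refine (h1.const_mul (-(2 / N))).congr_deriv ?_
  field_simp

theorem cutoff_nonneg (N y : ℝ) : 0 ≤ cutoff N y := sq_nonneg _

theorem cutoff_le_one {N y : ℝ} (hy : y ∈ Icc 0 N) : cutoff N y ≤ 1 := by
  have h1 : 0 ≤ y / N := div_nonneg hy.1 (hy.1.trans hy.2)
  have h2 : y / N ≤ 1 := div_le_one_of_le₀ hy.2 (hy.1.trans hy.2)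
  unfold cutoff
  nlinarith

@[fun_prop]
theorem continuous_cutoff (N : ℝ) : Continuous (cutoff N) := by unfold cutoff; fun_prop

theorem continuousOn_angle {X : Type*} [TopologicalSpace X] {S : Set X} {a b : X → ℝ}
    (ha : ContinuousOn a S) (hb : ContinuousOn b S) (hpos : ∀ q ∈ S, 0 < b q) :
    ContinuousOn (fun q => angle (a q) (b q)) S :=
  hb.div ((hb.pow 2).add (ha.pow 2)).sqrt fun q hq => (sqrt_sq_add_sq_pos (a q) (hpos q hq)).ne'

theorem continuousOn_angleDeriv {X : Type*} [TopologicalSpace X] {S : Set X} {a b a' b' : X → ℝ}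
    (ha : ContinuousOn a S) (hb : ContinuousOn b S) (ha' : ContinuousOn a' S)
    (hb' : ContinuousOn b' S) (hpos : ∀ q ∈ S, 0 < b q) :
    ContinuousOn (fun q => angleDeriv (a q) (b q) (a' q) (b' q)) S :=
  (ha.mul ((ha.mul hb').sub (hb.mul ha'))).div (((hb.pow 2).add (ha.pow 2)).sqrt.pow 3)
    fun q hq => pow_ne_zero 3 (sqrt_sq_add_sq_pos (a q) (hpos q hq)).ne'

theorem continuousOn_angleDeriv2 {X : Type*} [TopologicalSpace X] {S : Set X} {a b c d : X → ℝ}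
    (ha : ContinuousOn a S) (hb : ContinuousOn b S) (hc : ContinuousOn c S)
    (hd : ContinuousOn d S) (hpos : ∀ q ∈ S, 0 < b q) :
    ContinuousOn (fun q => angleDeriv2 (a q) (b q) (c q) (d q)) S := by
  have hs := ((hb.pow 2).add (ha.pow 2)).sqrt
  refine ContinuousOn.sub ((((ha.pow 2).mul hd).sub (hb.pow 3)).div (hs.pow 3) ?_)
    (ContinuousOn.div (((ha.mul ((ha.mul hc).sub (hb.mul hb))).const_mul 3).mul
      (hb.mul (ha.add hc))) (hs.pow 5) ?_)
  · exact fun q hq => pow_ne_zero 3 (sqrt_sq_add_sq_pos (a q) (hpos q hq)).ne'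
  · exact fun q hq => (sqrt_sq_add_sq_pos (a q) (hpos q hq)).ne' |> pow_ne_zero 5

/-! ### The ratio F = ∂_y u / √((∂_y u)² + u²) and its inequality across the layer. -/

/-- The quotient `∂_y u / √((∂_y u)² + u²)`. -/
noncomputable def ratio (u : ℝ → ℝ → ℝ → ℝ) (t x y : ℝ) : ℝ := angle (u t x y) (partialY u t x y)

/-- The time derivative of `ratio u`. -/
noncomputable def ratioT (T : ℝ) (u : ℝ → ℝ → ℝ → ℝ) (t x y : ℝ) : ℝ :=
  angleDeriv (u t x y) (partialY u t x y) (partialT T u t x y) (partialT T (partialY u) t x y)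

/-- The tangential derivative of `ratio u`. -/
noncomputable def ratioX (L : ℝ) (u : ℝ → ℝ → ℝ → ℝ) (t x y : ℝ) : ℝ :=
  angleDeriv (u t x y) (partialY u t x y) (partialX L u t x y) (partialX L (partialY u) t x y)

/-- The normal derivative of `ratio u`. -/
noncomputable def ratioY (u : ℝ → ℝ → ℝ → ℝ) (t x y : ℝ) : ℝ :=
  angleDeriv (u t x y) (partialY u t x y) (partialY u t x y) (partialY (partialY u) t x y)

/-- The second normal derivative of `ratio u`. -/
noncomputable def ratioYY (u : ℝ → ℝ → ℝ → ℝ) (t x y : ℝ) : ℝ :=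
  angleDeriv2 (u t x y) (partialY u t x y) (partialY (partialY u) t x y)
    (partialY (partialY (partialY u)) t x y)

/-- The vorticity is positive in the whole layer. -/
def PosVorticity (T L : ℝ) (u : ℝ → ℝ → ℝ → ℝ) : Prop :=
  ∀ t ∈ Ico 0 T, ∀ x ∈ Icc 0 L, ∀ y ≥ 0, 0 < partialY u t x y

namespace IsClassicalSolution

variable {T L : ℝ} {Ue P u₀ u₁ : ℝ → ℝ → ℝ} {u v : ℝ → ℝ → ℝ → ℝ} {t x y : ℝ}

theorem continuousOn_ratio (h : IsClassicalSolution T L Ue P u₀ u₁ u v)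
    (hw : PosVorticity T L u) :
    ContinuousOn (fun q : ℝ × ℝ × ℝ => ratio u q.1 q.2.1 q.2.2) (domain T L) :=
  continuousOn_angle h.regular_u.cont h.regular_u.cont_y
    fun q hq => hw q.1 hq.1 q.2.1 hq.2.1 q.2.2 hq.2.2

theorem continuousOn_ratioY (h : IsClassicalSolution T L Ue P u₀ u₁ u v)
    (hw : PosVorticity T L u) :
    ContinuousOn (fun q : ℝ × ℝ × ℝ => ratioY u q.1 q.2.1 q.2.2) (domain T L) :=
  continuousOn_angleDeriv h.regular_u.cont h.regular_u.cont_y h.regular_u.cont_y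
    h.regular_u.cont_yy fun q hq => hw q.1 hq.1 q.2.1 hq.2.1 q.2.2 hq.2.2

theorem continuousOn_ratioT (h : IsClassicalSolution T L Ue P u₀ u₁ u v)
    (hw : PosVorticity T L u) :
    ContinuousOn (fun q : ℝ × ℝ × ℝ => ratioT T u q.1 q.2.1 q.2.2) (openDomain T L) :=
  have hs := openDomain_subset (T := T) (L := L)
  continuousOn_angleDeriv (h.regular_u.cont.mono hs) (h.regular_u.cont_y.mono hs)
    (h.regular_u.cont_t.mono hs) h.regular_uy.cont_t
    fun q hq => hw q.1 (hs hq).1 q.2.1 (hs hq).2.1 q.2.2 (hs hq).2.2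

theorem continuousOn_ratioX (h : IsClassicalSolution T L Ue P u₀ u₁ u v)
    (hw : PosVorticity T L u) :
    ContinuousOn (fun q : ℝ × ℝ × ℝ => ratioX L u q.1 q.2.1 q.2.2) (openDomain T L) :=
  have hs := openDomain_subset (T := T) (L := L)
  continuousOn_angleDeriv (h.regular_u.cont.mono hs) (h.regular_u.cont_y.mono hs)
    (h.regular_u.cont_x.mono hs) h.regular_uy.cont_x
    fun q hq => hw q.1 (hs hq).1 q.2.1 (hs hq).2.1 q.2.2 (hs hq).2.2

theorem continuousOn_ratioYY (h : IsClassicalSolution T L Ue P u₀ u₁ u v)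
    (hw : PosVorticity T L u) :
    ContinuousOn (fun q : ℝ × ℝ × ℝ => ratioYY u q.1 q.2.1 q.2.2) (openDomain T L) :=
  have hs := openDomain_subset (T := T) (L := L)
  continuousOn_angleDeriv2 (h.regular_u.cont.mono hs) (h.regular_u.cont_y.mono hs)
    h.regular_uy.cont_y h.regular_uy.cont_yy
    fun q hq => hw q.1 (hs hq).1 q.2.1 (hs hq).2.1 q.2.2 (hs hq).2.2

theorem hasDerivAt_ratio_t (h : IsClassicalSolution T L Ue P u₀ u₁ u v) (hw : PosVorticity T L u)
    (ht : t ∈ Ioo 0 T) (hx : x ∈ Ioo 0 L) (hy : 0 < y) :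
    HasDerivAt (fun s => ratio u s x y) (ratioT T u t x y) t :=
  have hq : (t, x, y) ∈ openDomain T L := ⟨ht, hx, hy⟩
  have hq' := openDomain_subset hq
  hasDerivAt_angle (h.regular_u.hasDerivAt_t hq' ht) (h.regular_uy.hasDerivAt_t hq ht)
    (hw t hq'.1 x hq'.2.1 y hq'.2.2)

theorem hasDerivAt_ratio_x (h : IsClassicalSolution T L Ue P u₀ u₁ u v) (hw : PosVorticity T L u)
    (ht : t ∈ Ioo 0 T) (hx : x ∈ Ioo 0 L) (hy : 0 < y) :
    HasDerivAt (fun s => ratio u t s y) (ratioX L u t x y) x :=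
  have hq : (t, x, y) ∈ openDomain T L := ⟨ht, hx, hy⟩
  have hq' := openDomain_subset hq
  hasDerivAt_angle (a := fun s => u t s y) (b := fun s => partialY u t s y)
    (h.regular_u.hasDerivAt_x hq' hx) (h.regular_uy.hasDerivAt_x hq hx)
    (hw t hq'.1 x hq'.2.1 y hq'.2.2)

theorem hasDerivAt_ratio_y (h : IsClassicalSolution T L Ue P u₀ u₁ u v) (hw : PosVorticity T L u)
    (ht : t ∈ Ioo 0 T) (hx : x ∈ Ioo 0 L) (hy : 0 < y) :
    HasDerivAt (fun s => ratio u t x s) (ratioY u t x y) y :=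
  have hq' := openDomain_subset (show (t, x, y) ∈ openDomain T L from ⟨ht, hx, hy⟩)
  hasDerivAt_angle (h.regular_u.hasDerivAt_y hq' hy) (h.regular_u.hasDerivAt_yy hq' hy)
    (hw t hq'.1 x hq'.2.1 y hq'.2.2)

theorem hasDerivAt_ratioY (h : IsClassicalSolution T L Ue P u₀ u₁ u v) (hw : PosVorticity T L u)
    (ht : t ∈ Ioo 0 T) (hx : x ∈ Ioo 0 L) (hy : 0 < y) :
    HasDerivAt (fun s => ratioY u t x s) (ratioYY u t x y) y :=
  have hq : (t, x, y) ∈ openDomain T L := ⟨ht, hx, hy⟩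
  have hq' := openDomain_subset hq
  hasDerivAt_angleDeriv (a := fun s => u t x s) (b := fun s => partialY u t x s)
    (c := fun s => partialY (partialY u) t x s) (h.regular_u.hasDerivAt_y hq' hy)
    (h.regular_u.hasDerivAt_yy hq' hy) (h.regular_uy.hasDerivAt_yy hq hy)
    (hw t hq'.1 x hq'.2.1 y hy.le)

/-- The ratio is a supersolution of a forced advection-diffusion equation. -/
theorem ratioYY_le (h : IsClassicalSolution T L Ue P u₀ u₁ u v) (hw : PosVorticity T L u)
    (ht : t ∈ Ioo 0 T) (hx : x ∈ Ioo 0 L) (hy : 0 < y) :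
    ratioYY u t x y + pressureGradient L P t x *
        (u t x y * partialY u t x y / √(partialY u t x y ^ 2 + u t x y ^ 2) ^ 3) -
        ratio u t x y / 3 ≤
      ratioT T u t x y + u t x y * ratioX L u t x y + v t x y * ratioY u t x y := by
  have hq : (t, x, y) ∈ openDomain T L := ⟨ht, hx, hy⟩
  have hq' := openDomain_subset hq
  have hpos := hw t hq'.1 x hq'.2.1 y hq'.2.2
  refine (angleDeriv2_le hpos).trans_eq ?_
  have h1 := h.momentum t hq'.1 x hq'.2.1 y hq'.2.2
  have h2 := h.vorticity ht hx hy
  -- The transport derivative of u is ∂_y²u - ∂_xP and that of ∂_y u is ∂_y³u, so the algebraic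
  -- right-hand side is the transport derivative of F.
  rw [← h1, ← h2]
  simp only [ratioT, ratioX, ratioY, angleDeriv]
  ring

/-- The ratio integrated across the layer satisfies a differential inequality in `(t, x)`. -/
theorem layer_inequality (h : IsClassicalSolution T L Ue P u₀ u₁ u v) (hw : PosVorticity T L u)
    (ht : t ∈ Ioo 0 T) (hx : x ∈ Ioo 0 L) {ε N p U lam : ℝ} (hε : 0 < ε) (hεN : ε ≤ N)
    (hp : 0 ≤ p) (hpP : p ≤ pressureGradient L P t x) (hU : Ue t x ≤ U) (hl : 0 ≤ lam) :
    -(cutoff N ε * ratioY u t x ε - -(2 / N) * (1 - ε / N) * ratio u t x ε -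
        cutoff N ε * v t x ε * ratio u t x ε) +
      (∫ y in ε..N, -(2 / N) * (1 - y / N) * v t x y * ratio u t x y) +
      (3 * p * lam ^ 2 - 1 / 3) * (∫ y in ε..N, cutoff N y * ratio u t x y) -
      4 * p * lam ^ 3 * √U ≤
    (∫ y in ε..N, cutoff N y * ratioT T u t x y) +
      ∫ y in ε..N, cutoff N y *
        (partialX L u t x y * ratio u t x y + u t x y * ratioX L u t x y) := by
  have ht' : t ∈ Ico 0 T := ⟨ht.1.le, ht.2⟩
  have hx' : x ∈ Icc 0 L := ⟨hx.1.le, hx.2.le⟩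
  have hN : 0 < N := hε.trans_le hεN
  have hIcc : uIcc ε N = Icc ε N := uIcc_of_le hεN
  have hy0 : ∀ y ∈ Icc ε N, 0 < y := fun y hy => hε.trans_le hy.1
  have hwp : ∀ y ≥ 0, 0 < partialY u t x y := hw t ht' x hx'
  have hup : ∀ y > 0, 0 < u t x y := fun y hy => h.u_pos ht' hx' hy fun z hz => hwp z hz.le
  have slice : ∀ {f : ℝ → ℝ → ℝ → ℝ},
      ContinuousOn (fun q : ℝ × ℝ × ℝ => f q.1 q.2.1 q.2.2) (openDomain T L) →
      ContinuousOn (f t x) (Icc ε N) := fun hf =>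
    hf.comp (f := fun y => (t, x, y)) (by fun_prop) fun y hy => ⟨ht, hx, hy0 y hy⟩
  have hs := openDomain_subset (T := T) (L := L)
  have cF := slice ((h.continuousOn_ratio hw).mono hs)
  have cFy := slice ((h.continuousOn_ratioY hw).mono hs)
  have cFyy := slice (h.continuousOn_ratioYY hw)
  have cFt := slice (h.continuousOn_ratioT hw)
  have cFx := slice (h.continuousOn_ratioX hw)
  have cu := slice (h.regular_u.cont.mono hs)
  have cw := slice (h.regular_u.cont_y.mono hs)
  have cux := slice (h.regular_u.cont_x.mono hs)
  have cv := slice (h.cont_v.mono hs)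
  have cχ : ContinuousOn (cutoff N) (Icc ε N) := (continuous_cutoff N).continuousOn
  have cχ' : ContinuousOn (fun y => -(2 / N) * (1 - y / N)) (Icc ε N) := by fun_prop
  have ii : ∀ {g : ℝ → ℝ}, ContinuousOn g (Icc ε N) → IntervalIntegrable g volume ε N :=
    fun hg => ContinuousOn.intervalIntegrable (hIcc.symm ▸ hg)
  -- With χ the cutoff, this is the y-derivative of χF_y - χ'F - χvF after replacing ∂_y v by -∂_x
  -- u. The term χ ∂_x u F puts tangential transport into the divergence form ∂_x(uF).
  let Φ' : ℝ → ℝ := fun y => cutoff N y * ratioYY u t x y - 2 / N ^ 2 * ratio u t x y -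
    -(2 / N) * (1 - y / N) * v t x y * ratio u t x y +
    cutoff N y * partialX L u t x y * ratio u t x y - cutoff N y * v t x y * ratioY u t x y
  have cΦ' : ContinuousOn Φ' (Icc ε N) :=
    ((((cχ.mul cFyy).sub (continuousOn_const.mul cF)).sub ((cχ'.mul cv).mul cF)).add
      ((cχ.mul cux).mul cF)).sub ((cχ.mul cv).mul cFy)
  have iΦ : ∫ y in ε..N, Φ' y =
      -(cutoff N ε * ratioY u t x ε - -(2 / N) * (1 - ε / N) * ratio u t x ε -
        cutoff N ε * v t x ε * ratio u t x ε) := by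
    rw [intervalIntegral.integral_eq_sub_of_hasDerivAt
      (f := fun y => cutoff N y * ratioY u t x y - -(2 / N) * (1 - y / N) * ratio u t x y -
        cutoff N y * v t x y * ratio u t x y) ?_ (ii cΦ')]
    -- The cutoff and its slope both vanish at y = N, so only the boundary terms at ε remain.
    · have h1 : 1 - N / N = 0 := by rw [div_self hN.ne', sub_self]
      have h2 : cutoff N N = 0 := by rw [cutoff, h1]; norm_num
      rw [h1, h2]; ring
    · intro y hy
      have hy' := hy0 y (hIcc ▸ hy)
      have ev : HasDerivAt (fun z => v t x z) (partialY v t x y) y :=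
        (h.diff_v (t, x, y) ⟨ht', hx', hy'.le⟩).hasDerivWithinAt.hasDerivAt (Ici_mem_nhds hy')
      have eF := h.hasDerivAt_ratio_y hw ht hx hy'
      have eχ := hasDerivAt_cutoff N y
      have hdiv := h.incompressible t ht' x hx' y hy'.le
      refine (((eχ.fun_mul (h.hasDerivAt_ratioY hw ht hx hy')).fun_sub
        ((hasDerivAt_cutoff_deriv N y).fun_mul eF)).fun_sub
        ((eχ.fun_mul ev).fun_mul eF)).congr_deriv ?_
      simp only [Φ']
      rw [show partialY v t x y = -partialX L u t x y by linarith]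
      ring
  have cq : ContinuousOn (fun y => partialY u t x y / √(u t x y)) (Icc ε N) :=
    cw.div cu.sqrt fun y hy => (Real.sqrt_pos.2 (hup y (hy0 y hy))).ne'
  -- The error term of `angle_young` has the primitive 2√u, so its integral is bounded independently
  -- of the width of the layer.
  have iq : ∫ y in ε..N, partialY u t x y / √(u t x y) ≤ 2 * √U := by
    rw [intervalIntegral.integral_eq_sub_of_hasDerivAt (f := fun y => 2 * √(u t x y)) ?_ (ii cq)]
    · have h1 : √(u t x N) ≤ √U := Real.sqrt_le_sqrt
        ((h.u_le ht' hx' hN.le fun z hz => hwp z hz.le).trans hU)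
      have h2 : 0 ≤ √(u t x ε) := Real.sqrt_nonneg _
      linarith
    · intro y hy
      have hy' := hy0 y (hIcc ▸ hy)
      refine (((h.hasDerivAt_u ht' hx' hy').sqrt (hup y hy').ne').const_mul 2).congr_deriv ?_
      ring
  have hmono : ∫ y in ε..N, (Φ' y + -(2 / N) * (1 - y / N) * v t x y * ratio u t x y +
      (3 * p * lam ^ 2 - 1 / 3) * (cutoff N y * ratio u t x y) -
      2 * p * lam ^ 3 * (partialY u t x y / √(u t x y))) ≤
      ∫ y in ε..N, (cutoff N y * ratioT T u t x y + cutoff N y *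
        (partialX L u t x y * ratio u t x y + u t x y * ratioX L u t x y)) := by
    refine intervalIntegral.integral_mono_on hεN
      (ii (((cΦ'.add ((cχ'.mul cv).mul cF)).add ((cχ.mul cF).const_mul _)).sub (cq.const_mul _)))
      (ii ((cχ.mul cFt).add (cχ.mul ((cux.mul cF).add (cu.mul cFx))))) fun y hy => ?_
    have hy' := hy0 y hy
    have hwy := hwp y hy'.le
    have huy := hup y hy'
    have k1 := h.ratioYY_le hw ht hx hy'
    have k2 := angle_young huy hwy hl
    have hE : 0 ≤ u t x y * partialY u t x y / √(partialY u t x y ^ 2 + u t x y ^ 2) ^ 3 := by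
      positivity
    have hr : 0 ≤ ratio u t x y := angle_nonneg _ hwy.le
    have hq : 0 ≤ partialY u t x y / √(u t x y) := by positivity
    rw [show angle (u t x y) (partialY u t x y) = ratio u t x y from rfl] at k2
    simp only [Φ']
    set E := u t x y * partialY u t x y / √(partialY u t x y ^ 2 + u t x y ^ 2) ^ 3
    set Q := partialY u t x y / √(u t x y)
    have hχ0 := cutoff_nonneg N y
    have hχ1 : cutoff N y ≤ 1 := cutoff_le_one ⟨hy'.le, hy.2⟩
    have k3 : p * E ≤ pressureGradient L P t x * E := mul_le_mul_of_nonneg_right hpP hE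
    have k4 : p * (3 * lam ^ 2 * ratio u t x y - 2 * lam ^ 3 * Q) ≤ p * E :=
      mul_le_mul_of_nonneg_left k2 hp
    have k5 := mul_le_mul_of_nonneg_left (show ratioYY u t x y +
      p * (3 * lam ^ 2 * ratio u t x y - 2 * lam ^ 3 * Q) - ratio u t x y / 3 ≤
      ratioT T u t x y + u t x y * ratioX L u t x y + v t x y * ratioY u t x y by linarith) hχ0
    have k6 : cutoff N y * (2 * p * lam ^ 3 * Q) ≤ 1 * (2 * p * lam ^ 3 * Q) :=
      mul_le_mul_of_nonneg_right hχ1 (by positivity)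
    have k7 : 0 ≤ 2 / N ^ 2 * ratio u t x y := by positivity
    linarith
  have i₁ : IntervalIntegrable (fun y => -(2 / N) * (1 - y / N) * v t x y * ratio u t x y)
      volume ε N := ii ((cχ'.mul cv).mul cF)
  have i₂ : IntervalIntegrable (fun y => (3 * p * lam ^ 2 - 1 / 3) *
      (cutoff N y * ratio u t x y)) volume ε N := ii ((cχ.mul cF).const_mul _)
  have i₃ : IntervalIntegrable (fun y => 2 * p * lam ^ 3 * (partialY u t x y / √(u t x y)))
      volume ε N := ii (cq.const_mul _)
  have i₄ : IntervalIntegrable (fun y => cutoff N y * ratioT T u t x y) volume ε N :=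
    ii (cχ.mul cFt)
  have i₅ : IntervalIntegrable (fun y => cutoff N y *
      (partialX L u t x y * ratio u t x y + u t x y * ratioX L u t x y)) volume ε N :=
    ii (cχ.mul ((cux.mul cF).add (cu.mul cFx)))
  have i₆ : IntervalIntegrable (fun y => Φ' y + -(2 / N) * (1 - y / N) * v t x y * ratio u t x y)
      volume ε N := (ii cΦ').add i₁
  rw [intervalIntegral.integral_sub (i₆.add i₂) i₃, intervalIntegral.integral_add i₆ i₂,
    intervalIntegral.integral_add (ii cΦ') i₁, iΦ, intervalIntegral.integral_const_mul,
    intervalIntegral.integral_const_mul, intervalIntegral.integral_add i₄ i₅] at hmono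
  have hfin : 2 * p * lam ^ 3 * (∫ y in ε..N, partialY u t x y / √(u t x y)) ≤
      2 * p * lam ^ 3 * (2 * √U) := mul_le_mul_of_nonneg_left iq (by positivity)
  linarith

end IsClassicalSolution

/-! ### Smallness of the cutoff error and of the fluxes near the wall. -/

namespace IsClassicalSolution

variable {T L : ℝ} {Ue P u₀ u₁ : ℝ → ℝ → ℝ} {u v : ℝ → ℝ → ℝ → ℝ} {t x y : ℝ}

/-- The contribution of the normal velocity to the layer inequality is small for wide cutoffs. -/
theorem exists_cutoff_width (h : IsClassicalSolution T L Ue P u₀ u₁ u v) (hw : PosVorticity T L u)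
    (hUe : ContinuousOn (fun q : ℝ × ℝ => Ue q.1 q.2) (Icc 0 T ×ˢ Icc 0 L))
    (hUe_pos : ∀ t ∈ Icc 0 T, ∀ x ∈ Icc 0 L, 0 < Ue t x) {τ : ℝ} (hτ : τ < T) :
    ∃ N₀ ≥ 1, ∀ N ≥ N₀, ∀ t ∈ Icc 0 τ, ∀ x ∈ Icc 0 L, ∀ ε ∈ Ioc (0 : ℝ) 1,
      -1 ≤ ∫ y in ε..N, -(2 / N) * (1 - y / N) * v t x y * ratio u t x y := by
  obtain ⟨m, hm, hm'⟩ := (isCompact_Icc.prod isCompact_Icc).exists_forall_le'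
    (f := fun q : ℝ × ℝ => Ue q.1 q.2) (a := 0) hUe (fun q hq => hUe_pos q.1 hq.1 q.2 hq.2)
  obtain ⟨M₀, hM₀⟩ := h.bounded τ hτ
  set M := |M₀| with hMdef
  have hM0 : 0 ≤ M := abs_nonneg _
  -- The first bound gives u ≥ m/2 beyond Y; the second makes the contribution of y ≥ Y at most 1/2
  -- in size.
  set η := min (m / 2) (m / (8 * M + 8)) with hη
  have hη0 : 0 < η := by positivity
  obtain ⟨Y₀, hY₀⟩ := eventually_atTop.1
    (Metric.tendstoUniformlyOn_iff.1 (h.far_field τ hτ) η hη0)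
  set Y := max Y₀ 1 with hY
  have hY1 : 1 ≤ Y := le_max_right _ _
  -- For y ≤ Y the integral is at most 2MY²/N in size, hence at most 1/2 for such N.
  refine ⟨max Y (4 * M * Y ^ 2 + 1), hY1.trans (le_max_left _ _), ?_⟩
  intro N hN t ht x hx ε hε
  have hYN : Y ≤ N := (le_max_left _ _).trans hN
  have hMN : 4 * M * Y ^ 2 + 1 ≤ N := (le_max_right _ _).trans hN
  have hN0 : 0 < N := by linarith
  have hεY : ε ≤ Y := hε.2.trans hY1
  have ht' : t ∈ Ico 0 T := ⟨ht.1, ht.2.trans_lt hτ⟩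
  have hwp : ∀ y ≥ 0, 0 < partialY u t x y := hw t ht' x hx
  have hUm : m ≤ Ue t x := hm' (t, x) ⟨⟨ht.1, ht'.2.le⟩, hx⟩
  have hfar : ∀ y ≥ Y, Ue t x - η < u t x y := fun y hy => by
    have := hY₀ y ((le_max_left _ _).trans hy) (t, x) ⟨ht, hx⟩
    rw [Real.dist_eq] at this
    have := (abs_lt.1 this).2
    simp only at this
    linarith
  have hbound : ∀ y ∈ Icc 0 N, |-(2 / N) * (1 - y / N) * v t x y * ratio u t x y| ≤
      2 * M / N * (y * ratio u t x y) := by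
    intro y hy
    have hv : |v t x y| ≤ M * y := h.abs_v_le ht' hx hy.1
      fun z hz => (hM₀ t ht x hx z hz).1.trans (le_abs_self _)
    have hr : 0 ≤ ratio u t x y := angle_nonneg _ (hwp y hy.1).le
    have h1 : |1 - y / N| ≤ 1 := by
      have h1 : 0 ≤ y / N := div_nonneg hy.1 hN0.le
      have h2 : y / N ≤ 1 := div_le_one_of_le₀ hy.2 hN0.le
      rw [abs_le]; constructor <;> linarith
    rw [abs_mul, abs_mul, abs_mul, abs_neg, abs_of_nonneg hr,
      abs_of_nonneg (by positivity : 0 ≤ 2 / N)]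
    calc 2 / N * |1 - y / N| * |v t x y| * ratio u t x y
        ≤ 2 / N * 1 * (M * y) * ratio u t x y := by gcongr
      _ = _ := by ring
  have hcont : ContinuousOn (fun y => -(2 / N) * (1 - y / N) * v t x y * ratio u t x y)
      (Icc 0 N) := by
    have slice : ∀ {f : ℝ → ℝ → ℝ → ℝ},
        ContinuousOn (fun q : ℝ × ℝ × ℝ => f q.1 q.2.1 q.2.2) (domain T L) →
        ContinuousOn (f t x) (Icc 0 N) := fun hf =>
      hf.comp (f := fun y => (t, x, y)) (by fun_prop) fun y hy => ⟨ht', hx, hy.1⟩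
    exact ((by fun_prop : Continuous fun y => -(2 / N) * (1 - y / N)).continuousOn.mul
      (slice h.cont_v)).mul (slice (h.continuousOn_ratio hw))
  have ii : ∀ {g : ℝ → ℝ} {a b : ℝ}, 0 ≤ a → a ≤ b → b ≤ N → ContinuousOn g (Icc 0 N) →
      IntervalIntegrable g volume a b := fun ha hab hb hg =>
    ContinuousOn.intervalIntegrable ((uIcc_of_le hab).symm ▸ hg.mono (Icc_subset_Icc ha hb))
  rw [← intervalIntegral.integral_add_adjacent_intervals (ii hε.1.le hεY hYN hcont)
    (ii (by linarith) hYN le_rfl hcont)]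
  have I₁ : -(1 / 2) ≤ ∫ y in ε..Y, -(2 / N) * (1 - y / N) * v t x y * ratio u t x y := by
    have h1 : ∫ _ in ε..Y, -(2 * M / N * Y) ≤
        ∫ y in ε..Y, -(2 / N) * (1 - y / N) * v t x y * ratio u t x y := by
      refine intervalIntegral.integral_mono_on hεY intervalIntegrable_const
        (ii hε.1.le hεY hYN hcont) fun y hy => ?_
      have hy0 : 0 ≤ y := hε.1.le.trans hy.1
      have h1 := (abs_le.1 (hbound y ⟨hy0, hy.2.trans hYN⟩)).1
      have h2 : y * ratio u t x y ≤ Y * 1 :=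
        mul_le_mul hy.2 (angle_le_one _ (hwp y hy0)) (angle_nonneg _ (hwp y hy0).le) (by linarith)
      have h3 : 2 * M / N * (y * ratio u t x y) ≤ 2 * M / N * (Y * 1) :=
        mul_le_mul_of_nonneg_left h2 (by positivity)
      linarith
    refine le_trans ?_ h1
    rw [intervalIntegral.integral_const, smul_eq_mul]
    have h2 : (Y - ε) * (2 * M / N * Y) ≤ Y * (2 * M / N * Y) := by
      refine mul_le_mul_of_nonneg_right (by linarith [hε.1]) (by positivity)
    have h3 : Y * (2 * M / N * Y) ≤ 1 / 2 := by
      rw [show Y * (2 * M / N * Y) = 2 * M * Y ^ 2 / N by ring, div_le_iff₀ hN0]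
      linarith
    linarith
  -- Here v/N is merely bounded. Smallness comes from F ≤ (2/m) ∂_y u and from u increasing by at
  -- most η beyond Y.
  have I₂ : -(1 / 2) ≤ ∫ y in Y..N, -(2 / N) * (1 - y / N) * v t x y * ratio u t x y := by
    have hcw : ContinuousOn (partialY u t x) (Icc 0 N) :=
      (h.continuousOn_uy ht' hx).mono Icc_subset_Ici_self
    have h1 : ∫ y in Y..N, -(4 * M / m) * partialY u t x y ≤
        ∫ y in Y..N, -(2 / N) * (1 - y / N) * v t x y * ratio u t x y := by
      refine intervalIntegral.integral_mono_on hYN (ii (by linarith) hYN le_rfl (hcw.const_mul _))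
        (ii (by linarith) hYN le_rfl hcont) fun y hy => ?_
      have hy0 : 0 ≤ y := by linarith [hy.1]
      have h1 := (abs_le.1 (hbound y ⟨hy0, hy.2⟩)).1
      have hr := angle_nonneg (u t x y) (hwp y hy0).le
      have h2 : m / 2 * ratio u t x y ≤ partialY u t x y := by
        refine le_trans ?_ (mul_angle_le (u t x y) (hwp y hy0))
        refine mul_le_mul_of_nonneg_right ?_ hr
        linarith [hfar y hy.1, min_le_left (m / 2) (m / (8 * M + 8))]
      have h3 : ratio u t x y ≤ 2 / m * partialY u t x y := by
        have : 2 / m * (m / 2 * ratio u t x y) ≤ 2 / m * partialY u t x y :=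
          mul_le_mul_of_nonneg_left h2 (by positivity)
        rwa [show 2 / m * (m / 2 * ratio u t x y) = ratio u t x y by field_simp] at this
      have h4 : y * ratio u t x y ≤ N * (2 / m * partialY u t x y) :=
        mul_le_mul hy.2 h3 hr hN0.le
      have h5 : 2 * M / N * (y * ratio u t x y) ≤ 2 * M / N * (N * (2 / m * partialY u t x y)) :=
        mul_le_mul_of_nonneg_left h4 (by positivity)
      rw [show 2 * M / N * (N * (2 / m * partialY u t x y)) = 4 * M / m * partialY u t x y by
        field_simp; ring] at h5
      linarith
    refine le_trans ?_ h1
    rw [intervalIntegral.integral_const_mul, h.integral_uy ht' hx (by linarith) hYN]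
    have h2 : u t x N - u t x Y ≤ η := by
      have := h.u_le ht' hx hN0.le fun z hz => hwp z hz.le
      linarith [hfar Y le_rfl]
    have h3 : 4 * M / m * (u t x N - u t x Y) ≤ 4 * M / m * (m / (8 * M + 8)) :=
      mul_le_mul_of_nonneg_left (h2.trans (min_le_right _ _)) (by positivity)
    have h4 : 4 * M / m * (m / (8 * M + 8)) ≤ 1 / 2 := by
      rw [show 4 * M / m * (m / (8 * M + 8)) = 4 * M / (8 * M + 8) by field_simp,
        div_le_iff₀ (by positivity)]
      linarith
    linarith
  linarith

/-- The wall fluxes are small near the wall. -/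
theorem exists_wall_distance (h : IsClassicalSolution T L Ue P u₀ u₁ u v)
    (hw : PosVorticity T L u) {τ : ℝ} (hτ : τ < T) :
    ∃ ε₀ > 0, ∀ ε ∈ Ioo 0 ε₀, ∀ t ∈ Icc 0 τ, ∀ x ∈ Icc 0 L,
      |ratioY u t x ε| ≤ 1 ∧ |v t x ε| ≤ 1 := by
  have hev : ∀ᶠ ε in 𝓝 (0 : ℝ), ∀ q ∈ Icc 0 τ ×ˢ Icc 0 L,
      q ∈ Icc 0 τ ×ˢ Icc 0 L → 0 ≤ ε → |ratioY u q.1 q.2 ε| ≤ 1 ∧ |v q.1 q.2 ε| ≤ 1 := by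
    refine (isCompact_Icc.prod isCompact_Icc).eventually_forall_of_forall_eventually
      (P := fun ε (q : ℝ × ℝ) => q ∈ Icc 0 τ ×ˢ Icc 0 L → 0 ≤ ε →
        |ratioY u q.1 q.2 ε| ≤ 1 ∧ |v q.1 q.2 ε| ≤ 1) fun q hq => ?_
    have hqT : q.1 ∈ Ico 0 T := ⟨hq.1.1, hq.1.2.trans_lt hτ⟩
    have hmem : (q.1, q.2, (0 : ℝ)) ∈ domain T L := ⟨hqT, hq.2, self_mem_Ici⟩
    have c₁ := (h.continuousOn_ratioY hw _ hmem).abs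
    have c₂ := (h.cont_v _ hmem).abs
    -- F_y carries a factor u, which vanishes on the wall by the no-slip condition.
    have z₁ : |ratioY u q.1 q.2 0| < 1 := by
      simp [ratioY, angleDeriv, h.wall_u q.1 hqT q.2 hq.2]
    have z₂ : |v q.1 q.2 0| < 1 := by simp [h.wall_v q.1 hqT q.2 hq.2]
    have e := eventually_nhdsWithin_iff.1
      ((c₁.eventually (gt_mem_nhds z₁)).and (c₂.eventually (gt_mem_nhds z₂)))
    have hmap : Tendsto (fun p : ℝ × ℝ × ℝ => (p.2.1, p.2.2, p.1)) (𝓝 (0, q))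
        (𝓝 (q.1, q.2, 0)) := by
      have : Continuous (fun p : ℝ × ℝ × ℝ => (p.2.1, p.2.2, p.1)) := by fun_prop
      exact this.tendsto (0, q)
    filter_upwards [hmap.eventually e] with p hp hp1 hp2
    have := hp ⟨⟨hp1.1.1, hp1.1.2.trans_lt hτ⟩, hp1.2, hp2⟩
    exact ⟨this.1.le, this.2.le⟩
  obtain ⟨ε₀, hε₀, hb⟩ := (nhdsGE_basis (0 : ℝ)).mem_iff.1 (mem_nhdsWithin_of_mem_nhds hev)
  exact ⟨ε₀, hε₀, fun ε hε t ht x hx =>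
    hb ⟨hε.1.le, hε.2⟩ (t, x) ⟨ht, hx⟩ ⟨ht, hx⟩ hε.1.le⟩

/-- The 4 consists of 1 from the diffusive flux, 2 from the slope of the cutoff (as N ≥ 1) and 1
from v. Together with the 1 of `exists_cutoff_width` it accounts for the -5 in `hasDerivAt_energy`.
-/
theorem boundary_terms_le {N ε a r w : ℝ} (hN : 1 ≤ N) (hε : ε ∈ Icc 0 N) (ha : |a| ≤ 1)
    (hw : |w| ≤ 1) (hr0 : 0 ≤ r) (hr1 : r ≤ 1) :
    cutoff N ε * a - -(2 / N) * (1 - ε / N) * r - cutoff N ε * w * r ≤ 4 := by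
  have h1 : cutoff N ε * a ≤ 1 * 1 :=
    (mul_le_mul_of_nonneg_left ((le_abs_self a).trans ha) (cutoff_nonneg N ε)).trans
      (mul_le_mul_of_nonneg_right (cutoff_le_one hε) zero_le_one)
  have h2 : -w * r ≤ 1 * 1 := mul_le_mul (by linarith [(abs_le.1 hw).1]) hr1 hr0 zero_le_one
  have h3 : cutoff N ε * (-w * r) ≤ 1 * 1 :=
    (mul_le_mul_of_nonneg_left (h2.trans_eq (one_mul 1)) (cutoff_nonneg N ε)).trans
      (mul_le_mul_of_nonneg_right (cutoff_le_one hε) zero_le_one)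
  have h4 : ε / N ≤ 1 := div_le_one_of_le₀ hε.2 (by linarith)
  have h4' : 0 ≤ ε / N := div_nonneg hε.1 (by linarith)
  have h5 : 2 / N ≤ 2 := div_le_self (by norm_num) hN
  have h6 : (1 - ε / N) * r ≤ 1 * 1 := mul_le_mul (by linarith) hr1 hr0 zero_le_one
  have h7 : 2 / N * ((1 - ε / N) * r) ≤ 2 * (1 * 1) :=
    mul_le_mul h5 h6 (mul_nonneg (by linarith) hr0) (by norm_num)
  linarith

end IsClassicalSolution

/-! ### The weighted energy and its differential inequality. -/

/-- The integral of the ratio with weight `(L - x)^{3/2}` over `[x₁, x₂] × [ε, N]`, with a cutoff. -/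
noncomputable def energy (L : ℝ) (u : ℝ → ℝ → ℝ → ℝ) (x₁ x₂ ε N t : ℝ) : ℝ :=
  ∫ x in x₁..x₂, (L - x) ^ (3 / 2 : ℝ) * ∫ y in ε..N, cutoff N y * ratio u t x y

theorem continuous_weight (L : ℝ) : Continuous fun x : ℝ => (L - x) ^ (3 / 2 : ℝ) :=
  (Real.continuous_rpow_const (by norm_num)).comp (by fun_prop)

theorem hasDerivAt_weight {L x : ℝ} (hx : x < L) :
    HasDerivAt (fun x : ℝ => (L - x) ^ (3 / 2 : ℝ)) (-(3 / 2 * (L - x) ^ (1 / 2 : ℝ))) x := by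
  have h1 : HasDerivAt (fun x => L - x) (-1) x := by simpa using (hasDerivAt_id x).const_sub L
  refine (h1.rpow_const (p := 3 / 2) (Or.inl (sub_pos.2 hx).ne')).congr_deriv ?_
  norm_num

theorem weight_nonneg {L x : ℝ} (hx : x ≤ L) : 0 ≤ (L - x) ^ (3 / 2 : ℝ) :=
  Real.rpow_nonneg (sub_nonneg.2 hx) _

theorem weight_le {L x : ℝ} (hx : x ∈ Icc 0 L) : (L - x) ^ (3 / 2 : ℝ) ≤ L ^ (3 / 2 : ℝ) :=
  Real.rpow_le_rpow (sub_nonneg.2 hx.2) (by linarith [hx.1]) (by norm_num)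

namespace IsClassicalSolution

variable {T L : ℝ} {Ue P u₀ u₁ : ℝ → ℝ → ℝ} {u v : ℝ → ℝ → ℝ → ℝ} {t x y : ℝ}

theorem continuousOn_energy (h : IsClassicalSolution T L Ue P u₀ u₁ u v)
    (hw : PosVorticity T L u) {τ x₁ x₂ ε N : ℝ} (hτ : τ < T) (hx₁ : 0 ≤ x₁) (hx : x₁ ≤ x₂)
    (hx₂ : x₂ ≤ L) (hε : 0 ≤ ε) (hεN : ε ≤ N) :
    ContinuousOn (energy L u x₁ x₂ ε N) (Icc 0 τ) := by
  refine continuousOn_intervalIntegral isCompact_Icc hx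
    (f := fun t x => (L - x) ^ (3 / 2 : ℝ) * ∫ y in ε..N, cutoff N y * ratio u t x y) ?_
  refine ((continuous_weight L).comp continuous_snd).continuousOn.mul ?_
  refine continuousOn_intervalIntegral (isCompact_Icc.prod isCompact_Icc) hεN
    (f := fun (q : ℝ × ℝ) y => cutoff N y * ratio u q.1 q.2 y) ?_
  refine ((continuous_cutoff N).comp continuous_snd).continuousOn.mul ?_
  exact (h.continuousOn_ratio hw).comp (f := fun p : (ℝ × ℝ) × ℝ => (p.1.1, p.1.2, p.2))
    (by fun_prop) fun p hp => ⟨⟨hp.1.1.1, hp.1.1.2.trans_lt hτ⟩,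
      ⟨hx₁.trans hp.1.2.1, hp.1.2.2.trans hx₂⟩, hε.trans hp.2.1⟩

/-- The differential inequality for the energy. -/
theorem hasDerivAt_energy (h : IsClassicalSolution T L Ue P u₀ u₁ u v)
    (hw : PosVorticity T L u) {x₁ x₂ ε N p U : ℝ} (ht : t ∈ Ioo 0 T) (hx₁ : 0 < x₁)
    (hx : x₁ ≤ x₂) (hx₂ : x₂ < L) (hε : 0 < ε) (hεN : ε ≤ N) (hp : 0 ≤ p)
    (hpP : ∀ x ∈ Icc 0 L, p ≤ pressureGradient L P t x) (hU : ∀ x ∈ Icc 0 L, Ue t x ≤ U)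
    (hflux : ∀ x ∈ Icc 0 L, -5 ≤
      -(cutoff N ε * ratioY u t x ε - -(2 / N) * (1 - ε / N) * ratio u t x ε -
        cutoff N ε * v t x ε * ratio u t x ε) +
      (∫ y in ε..N, -(2 / N) * (1 - y / N) * v t x y * ratio u t x y)) :
    ∃ A', HasDerivAt (energy L u x₁ x₂ ε N) A' t ∧ ∀ lam ≥ 0,
      (3 * p * lam ^ 2 - 1 / 3) * energy L u x₁ x₂ ε N t -
        (4 * p * lam ^ 3 * √U + 5) * (L ^ (3 / 2 : ℝ) * L) - U * L ^ (3 / 2 : ℝ) ≤ A' := by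
  have ht' : t ∈ Ico 0 T := ⟨ht.1.le, ht.2⟩
  have hN : 0 < N := hε.trans_le hεN
  have hL : 0 < L := by linarith
  have hxs : ∀ x ∈ Icc x₁ x₂, x ∈ Ioo 0 L := fun x hx => ⟨hx₁.trans_le hx.1, hx.2.trans_lt hx₂⟩
  have hxs' : ∀ x ∈ Icc x₁ x₂, x ∈ Icc 0 L := fun x hx => Ioo_subset_Icc_self (hxs x hx)
  have hIcc : uIcc x₁ x₂ = Icc x₁ x₂ := uIcc_of_le hx
  have hs := openDomain_subset (T := T) (L := L)
  have hU0 : 0 ≤ U := by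
    have h1 := h.u_nonneg ht' (left_mem_Icc.2 hL.le) hN.le
      fun z hz => (hw t ht' 0 (left_mem_Icc.2 hL.le) z hz.1.le).le
    exact h1.trans ((h.u_le ht' (left_mem_Icc.2 hL.le) hN.le
      fun z hz => hw t ht' 0 (left_mem_Icc.2 hL.le) z hz.le).trans (hU 0 (left_mem_Icc.2 hL.le)))
  -- continuity of slices and of layer integrals
  have pair : ∀ {f : ℝ → ℝ → ℝ → ℝ},
      ContinuousOn (fun q : ℝ × ℝ × ℝ => f q.1 q.2.1 q.2.2) (openDomain T L) →
      ContinuousOn (fun q : ℝ × ℝ => f t q.1 q.2) (Icc x₁ x₂ ×ˢ Icc ε N) := fun hf =>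
    hf.comp (f := fun q : ℝ × ℝ => (t, q.1, q.2)) (by fun_prop)
      fun q hq => ⟨ht, hxs _ hq.1, hε.trans_le hq.2.1⟩
  have cF := pair ((h.continuousOn_ratio hw).mono hs)
  have cFx := pair (h.continuousOn_ratioX hw)
  have cu := pair (h.regular_u.cont.mono hs)
  have cux := pair (h.regular_u.cont_x.mono hs)
  have cχ : ContinuousOn (fun q : ℝ × ℝ => cutoff N q.2) (Icc x₁ x₂ ×ˢ Icc ε N) :=
    ((continuous_cutoff N).comp continuous_snd).continuousOn
  let J : ℝ → ℝ → ℝ := fun s x => ∫ y in ε..N, cutoff N y * ratio u s x y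
  let JT : ℝ → ℝ → ℝ := fun s x => ∫ y in ε..N, cutoff N y * ratioT T u s x y
  let M : ℝ → ℝ := fun x => ∫ y in ε..N, cutoff N y * (u t x y * ratio u t x y)
  let MX : ℝ → ℝ := fun x => ∫ y in ε..N, cutoff N y *
    (partialX L u t x y * ratio u t x y + u t x y * ratioX L u t x y)
  have cM : ContinuousOn M (Icc x₁ x₂) :=
    continuousOn_intervalIntegral isCompact_Icc hεN (cχ.mul (cu.mul cF))
  have cMX : ContinuousOn MX (Icc x₁ x₂) :=
    continuousOn_intervalIntegral isCompact_Icc hεN (cχ.mul ((cux.mul cF).add (cu.mul cFx)))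
  have triple : ∀ {f : ℝ → ℝ → ℝ → ℝ} {a b : ℝ}, Icc a b ⊆ Ioo 0 T →
      ContinuousOn (fun q : ℝ × ℝ × ℝ => f q.1 q.2.1 q.2.2) (openDomain T L) →
      ContinuousOn (fun q : ℝ × ℝ => ∫ y in ε..N, cutoff N y * f q.1 q.2 y)
        (Icc a b ×ˢ Icc x₁ x₂) := by
    intro f a b hab hf
    refine continuousOn_intervalIntegral (isCompact_Icc.prod isCompact_Icc) hεN
      (f := fun (q : ℝ × ℝ) y => cutoff N y * f q.1 q.2 y) ?_
    refine ((continuous_cutoff N).comp continuous_snd).continuousOn.mul ?_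
    exact hf.comp (f := fun p : (ℝ × ℝ) × ℝ => (p.1.1, p.1.2, p.2))
      (by fun_prop) fun p hp => ⟨hab hp.1.1, hxs _ hp.1.2, hε.trans_le hp.2.1⟩
  have cJ : ∀ s ∈ Ioo 0 T, ContinuousOn (J s) (Icc x₁ x₂) := fun s hs' =>
    (triple (a := s) (b := s) (by simpa using hs')
      ((h.continuousOn_ratio hw).mono hs)).comp (f := fun x => (s, x)) (by fun_prop)
      fun x hx => ⟨by simp, hx⟩
  have cJT : ContinuousOn (JT t) (Icc x₁ x₂) :=
    (triple (a := t) (b := t) (by simpa using ht) (h.continuousOn_ratioT hw)).comp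
      (f := fun x => (t, x)) (by fun_prop) fun x hx => ⟨by simp, hx⟩
  have cφ := (continuous_weight L).continuousOn (s := Icc x₁ x₂)
  -- derivatives of layer integrals
  have dJ : ∀ s ∈ Ioo 0 T, ∀ x ∈ Icc x₁ x₂, HasDerivAt (fun s => J s x) (JT s x) s := by
    intro s hs' x hx
    refine hasDerivAt_intervalIntegral (f := fun s y => cutoff N y * ratio u s x y)
      (f' := fun s y => cutoff N y * ratioT T u s x y) hs' hεN ?_ ?_ ?_
    · intro r hr
      refine (continuous_cutoff N).continuousOn.mul ?_
      exact (h.continuousOn_ratio hw).comp (f := fun y => (r, x, y)) (by fun_prop)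
        fun y hy => hs ⟨hr, hxs x hx, hε.trans_le hy.1⟩
    · refine ((continuous_cutoff N).comp continuous_snd).continuousOn.mul ?_
      exact (h.continuousOn_ratioT hw).comp (f := fun q : ℝ × ℝ => (q.1, x, q.2)) (by fun_prop)
        fun q hq => ⟨hq.1, hxs x hx, hε.trans_le hq.2.1⟩
    · exact fun r hr y hy =>
        (h.hasDerivAt_ratio_t hw hr (hxs x hx) (hε.trans_le hy.1)).const_mul _
  have dM : ∀ x ∈ Icc x₁ x₂, HasDerivAt M (MX x) x := by
    intro x hx
    refine hasDerivAt_intervalIntegral (α := 0) (β := L)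
      (f := fun x y => cutoff N y * (u t x y * ratio u t x y))
      (f' := fun x y => cutoff N y *
        (partialX L u t x y * ratio u t x y + u t x y * ratioX L u t x y)) (hxs x hx) hεN ?_ ?_ ?_
    · intro r hr
      refine (continuous_cutoff N).continuousOn.mul
        (((h.continuousOn_u ht' (Ioo_subset_Icc_self hr)).mono
          fun y hy => hε.le.trans hy.1).mul ?_)
      exact (h.continuousOn_ratio hw).comp (f := fun y => (t, r, y)) (by fun_prop)
        fun y hy => hs ⟨ht, hr, hε.trans_le hy.1⟩
    · have pair' : ∀ {f : ℝ → ℝ → ℝ → ℝ},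
          ContinuousOn (fun q : ℝ × ℝ × ℝ => f q.1 q.2.1 q.2.2) (openDomain T L) →
          ContinuousOn (fun q : ℝ × ℝ => f t q.1 q.2) (Ioo 0 L ×ˢ Icc ε N) := fun hf =>
        hf.comp (f := fun q : ℝ × ℝ => (t, q.1, q.2)) (by fun_prop)
          fun q hq => ⟨ht, hq.1, hε.trans_le hq.2.1⟩
      exact ((continuous_cutoff N).comp continuous_snd).continuousOn.mul
        (((pair' (h.regular_u.cont_x.mono hs)).mul
          (pair' ((h.continuousOn_ratio hw).mono hs))).add
        ((pair' (h.regular_u.cont.mono hs)).mul (pair' (h.continuousOn_ratioX hw))))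
    · intro r hr y hy
      have hy0 := hε.trans_le hy.1
      exact ((h.regular_u.hasDerivAt_x (hs ⟨ht, hr, hy0⟩) hr).fun_mul
        (h.hasDerivAt_ratio_x hw ht hr hy0)).const_mul _
  have dE : HasDerivAt (energy L u x₁ x₂ ε N)
      (∫ x in x₁..x₂, (L - x) ^ (3 / 2 : ℝ) * JT t x) t := by
    obtain ⟨a, ha1, ha2⟩ := exists_between ht.1
    obtain ⟨b, hb1, hb2⟩ := exists_between ht.2
    have hab : Icc a b ⊆ Ioo 0 T := fun s hs => ⟨ha1.trans_le hs.1, hs.2.trans_lt hb2⟩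
    refine hasDerivAt_intervalIntegral (α := a) (β := b)
      (f := fun s x => (L - x) ^ (3 / 2 : ℝ) * J s x)
      (f' := fun s x => (L - x) ^ (3 / 2 : ℝ) * JT s x) ⟨ha2, hb1⟩ hx ?_ ?_ ?_
    · exact fun r hr => cφ.mul (cJ r (hab (Ioo_subset_Icc_self hr)))
    · refine ((continuous_weight L).comp continuous_snd).continuousOn.mul ?_
      exact (triple hab (h.continuousOn_ratioT hw)).mono
        (prod_mono Ioo_subset_Icc_self Subset.rfl)
    · exact fun r hr x hx => (dJ r (hab (Ioo_subset_Icc_self hr)) x hx).const_mul _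
  refine ⟨_, dE, fun lam hl => ?_⟩
  have ii : ∀ {g : ℝ → ℝ}, ContinuousOn g (Icc x₁ x₂) → IntervalIntegrable g volume x₁ x₂ :=
    fun hg => ContinuousOn.intervalIntegrable (hIcc.symm ▸ hg)
  -- bounds for the tangential flux
  have hMb : ∀ x ∈ Icc x₁ x₂, 0 ≤ M x ∧ M x ≤ U := by
    intro x hx
    have hx' := hxs' x hx
    have hwp : ∀ y ≥ 0, 0 < partialY u t x y := hw t ht' x hx'
    have hyN : ∀ y ∈ Icc ε N, 0 < y := fun y hy => hε.trans_le hy.1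
    have hnn : ∀ y ∈ Icc ε N, 0 ≤ u t x y * ratio u t x y := fun y hy =>
      mul_nonneg (h.u_pos ht' hx' (hyN y hy) fun z hz => hwp z hz.le).le
        (angle_nonneg _ (hwp y (hyN y hy).le).le)
    refine ⟨intervalIntegral.integral_nonneg hεN fun y hy =>
      mul_nonneg (cutoff_nonneg N y) (hnn y hy), ?_⟩
    have hsub : Icc ε N ⊆ Ici 0 := fun y hy => (hyN y hy).le
    have c₁ : ContinuousOn (fun y => cutoff N y * (u t x y * ratio u t x y)) (uIcc ε N) := by
      rw [uIcc_of_le hεN]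
      exact (cχ.mul (cu.mul cF)).comp (f := fun y => (x, y)) (by fun_prop) fun y hy => ⟨hx, hy⟩
    have c₂ : ContinuousOn (partialY u t x) (uIcc ε N) := by
      rw [uIcc_of_le hεN]; exact (h.continuousOn_uy ht' hx').mono hsub
    calc M x ≤ ∫ y in ε..N, partialY u t x y := by
          refine intervalIntegral.integral_mono_on hεN c₁.intervalIntegrable
            c₂.intervalIntegrable fun y hy => ?_
          have h1 := mul_angle_le (u t x y) (hwp y (hyN y hy).le)
          have h2 : cutoff N y * (u t x y * ratio u t x y) ≤ 1 * (u t x y * ratio u t x y) :=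
            mul_le_mul_of_nonneg_right (cutoff_le_one ⟨(hyN y hy).le, hy.2⟩) (hnn y hy)
          rw [one_mul] at h2
          exact h2.trans h1
      _ = u t x N - u t x ε := h.integral_uy ht' hx' hε.le hεN
      _ ≤ U := by
          have h1 := h.u_le ht' hx' hN.le fun z hz => hwp z hz.le
          have h2 := (h.u_pos ht' hx' hε fun z hz => hwp z hz.le).le
          linarith [hU x hx']
  have cφ' : ContinuousOn (fun x : ℝ => -(3 / 2 * (L - x) ^ (1 / 2 : ℝ))) (Icc x₁ x₂) :=
    (((Real.continuous_rpow_const (by norm_num)).comp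
      (by fun_prop : Continuous fun x : ℝ => L - x)).continuousOn.const_mul _).neg
  -- Integration by parts in x. As the weight decreases and 0 ≤ M ≤ U, replacing M by U in the
  -- integral and at x₂ and dropping the term at x₁ leaves U times the weight at x₁.
  have hflx : ∫ x in x₁..x₂, (L - x) ^ (3 / 2 : ℝ) * MX x ≤ U * L ^ (3 / 2 : ℝ) := by
    have dφ : ∀ x ∈ uIcc x₁ x₂, HasDerivAt (fun x : ℝ => (L - x) ^ (3 / 2 : ℝ))
        (-(3 / 2 * (L - x) ^ (1 / 2 : ℝ))) x := fun x hx =>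
      hasDerivAt_weight (hxs x (hIcc ▸ hx)).2
    rw [intervalIntegral.integral_mul_deriv_eq_deriv_mul dφ
      (fun x hx => dM x (hIcc ▸ hx)) (ii cφ') (ii cMX)]
    have h1 : ∫ x in x₁..x₂, -(3 / 2 * (L - x) ^ (1 / 2 : ℝ)) * U ≤
        ∫ x in x₁..x₂, -(3 / 2 * (L - x) ^ (1 / 2 : ℝ)) * M x := by
      refine intervalIntegral.integral_mono_on hx (ii (cφ'.mul continuousOn_const))
        (ii (cφ'.mul cM)) fun x hx => ?_
      refine mul_le_mul_of_nonpos_left (hMb x hx).2 ?_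
      have := Real.rpow_nonneg (sub_nonneg.2 (hxs' x hx).2) (1 / 2)
      linarith
    rw [intervalIntegral.integral_mul_const,
      intervalIntegral.integral_eq_sub_of_hasDerivAt dφ (ii cφ')] at h1
    have h2 := hMb x₁ (left_mem_Icc.2 hx)
    have h3 := hMb x₂ (right_mem_Icc.2 hx)
    have w₁ := weight_nonneg (hxs' x₁ (left_mem_Icc.2 hx)).2
    have w₂ := weight_nonneg (hxs' x₂ (right_mem_Icc.2 hx)).2
    have w₃ := weight_le (hxs' x₁ (left_mem_Icc.2 hx))
    have h4 := mul_le_mul_of_nonneg_left h3.2 w₂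
    have h5 := mul_nonneg w₁ h2.1
    have h6 := mul_le_mul_of_nonneg_left w₃ hU0
    linarith
  have hmono : ∫ x in x₁..x₂, ((3 * p * lam ^ 2 - 1 / 3) * ((L - x) ^ (3 / 2 : ℝ) * J t x) -
      (4 * p * lam ^ 3 * √U + 5) * L ^ (3 / 2 : ℝ) - (L - x) ^ (3 / 2 : ℝ) * MX x) ≤
      ∫ x in x₁..x₂, (L - x) ^ (3 / 2 : ℝ) * JT t x := by
    refine intervalIntegral.integral_mono_on hx
      (ii (((cφ.mul (cJ t ht)).const_mul _).sub continuousOn_const |>.sub (cφ.mul cMX)))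
      (ii (cφ.mul cJT)) fun x hx => ?_
    have hx' := hxs' x hx
    have k1 := h.layer_inequality hw ht (hxs x hx) hε hεN hp (hpP x hx') (hU x hx') hl
    have k2 := hflux x hx'
    have w₁ := weight_nonneg hx'.2
    have w₃ := weight_le hx'
    have k3 : (3 * p * lam ^ 2 - 1 / 3) * J t x - (4 * p * lam ^ 3 * √U + 5) - MX x ≤ JT t x := by
      simp only [J, JT, MX]; linarith
    have k4 := mul_le_mul_of_nonneg_left k3 w₁
    have k5 := mul_le_mul_of_nonneg_right w₃
      (show 0 ≤ 4 * p * lam ^ 3 * √U + 5 by positivity)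
    linarith
  have i₁ : IntervalIntegrable (fun x => (3 * p * lam ^ 2 - 1 / 3) *
      ((L - x) ^ (3 / 2 : ℝ) * J t x)) volume x₁ x₂ := ii ((cφ.mul (cJ t ht)).const_mul _)
  have i₂ : IntervalIntegrable (fun x => (L - x) ^ (3 / 2 : ℝ) * MX x) volume x₁ x₂ :=
    ii (cφ.mul cMX)
  rw [intervalIntegral.integral_sub (i₁.sub intervalIntegrable_const) i₂,
    intervalIntegral.integral_sub i₁ intervalIntegrable_const,
    intervalIntegral.integral_const_mul, intervalIntegral.integral_const, smul_eq_mul] at hmono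
  have hlen : (x₂ - x₁) * ((4 * p * lam ^ 3 * √U + 5) * L ^ (3 / 2 : ℝ)) ≤
      L * ((4 * p * lam ^ 3 * √U + 5) * L ^ (3 / 2 : ℝ)) :=
    mul_le_mul_of_nonneg_right (by linarith) (by positivity)
  have hE : energy L u x₁ x₂ ε N t = ∫ x in x₁..x₂, (L - x) ^ (3 / 2 : ℝ) * J t x := rfl
  rw [hE]
  linarith

end IsClassicalSolution

/-! ### Bounds uniform in the pressure, and passage to the full initial integral. -/

/-- An adverse pressure gradient is bounded below by a constant that depends only on `U_e`. -/
theorem exists_pressure_lower_bound {T L : ℝ} (hT : 0 < T) (hL : 0 < L) {Ue : ℝ → ℝ → ℝ}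
    (hUe : ContDiffOn ℝ 1 (fun q : ℝ × ℝ => Ue q.1 q.2) (Icc 0 T ×ˢ Icc 0 L)) :
    ∃ p > 0, ∀ P : ℝ → ℝ → ℝ, Bernoulli T L Ue P → AdversePressure T L P →
      ∀ t ∈ Icc 0 T, ∀ x ∈ Icc 0 L, p ≤ pressureGradient L P t x := by
  have hud : UniqueDiffOn ℝ (Icc 0 T ×ˢ Icc 0 L) :=
    (uniqueDiffOn_Icc hT).prod (uniqueDiffOn_Icc hL)
  set D := fderivWithin ℝ (fun q : ℝ × ℝ => Ue q.1 q.2) (Icc 0 T ×ˢ Icc 0 L) with hD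
  have hDc : ContinuousOn D (Icc 0 T ×ˢ Icc 0 L) := hUe.continuousOn_fderivWithin hud le_rfl
  have hd : ∀ q ∈ Icc 0 T ×ˢ Icc 0 L, HasFDerivWithinAt (fun q : ℝ × ℝ => Ue q.1 q.2) (D q)
      (Icc 0 T ×ˢ Icc 0 L) q := fun q hq =>
    (hUe.differentiableOn one_ne_zero q hq).hasFDerivWithinAt
  have hdt : ∀ t ∈ Icc 0 T, ∀ x ∈ Icc 0 L,
      derivWithin (fun s => Ue s x) (Icc 0 T) t = D (t, x) (1, 0) := by
    intro t ht x hx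
    have h1 : HasDerivWithinAt (fun s => (s, x)) ((1 : ℝ), (0 : ℝ)) (Icc 0 T) t :=
      (hasDerivWithinAt_id t _).prodMk (hasDerivWithinAt_const t _ x)
    have h2 : MapsTo (fun s => (s, x)) (Icc 0 T) (Icc 0 T ×ˢ Icc 0 L) := fun s hs => ⟨hs, hx⟩
    exact ((hd (t, x) ⟨ht, hx⟩).comp_hasDerivWithinAt t h1 h2).derivWithin (uniqueDiffOn_Icc hT t ht)
  have hdx : ∀ t ∈ Icc 0 T, ∀ x ∈ Icc 0 L,
      derivWithin (fun s => Ue t s) (Icc 0 L) x = D (t, x) (0, 1) := by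
    intro t ht x hx
    have h1 : HasDerivWithinAt (fun s => (t, s)) ((0 : ℝ), (1 : ℝ)) (Icc 0 L) x :=
      (hasDerivWithinAt_const x _ t).prodMk (hasDerivWithinAt_id x _)
    have h2 : MapsTo (fun s => (t, s)) (Icc 0 L) (Icc 0 T ×ˢ Icc 0 L) := fun s hs => ⟨ht, hs⟩
    exact ((hd (t, x) ⟨ht, hx⟩).comp_hasDerivWithinAt x h1 h2).derivWithin (uniqueDiffOn_Icc hL x hx)
  have hc : ContinuousOn (fun q : ℝ × ℝ => -(D q (1, 0) + Ue q.1 q.2 * D q (0, 1)))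
      (Icc 0 T ×ˢ Icc 0 L) :=
    ((hDc.clm_apply continuousOn_const).add
      (hUe.continuousOn.mul (hDc.clm_apply continuousOn_const))).neg
  have heq : ∀ P : ℝ → ℝ → ℝ, Bernoulli T L Ue P → ∀ t ∈ Icc 0 T, ∀ x ∈ Icc 0 L,
      -(D (t, x) (1, 0) + Ue t x * D (t, x) (0, 1)) = pressureGradient L P t x := by
    intro P hB t ht x hx
    have := hB t ht x hx
    rw [hdt t ht x hx, hdx t ht x hx] at this
    linarith
  -- Bernoulli's law makes ∂_xP the same continuous function of U_e for every admissible P. If that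
  -- function is not positive everywhere, no admissible P exists and any constant serves.
  by_cases hpos : ∀ q ∈ Icc 0 T ×ˢ Icc 0 L, 0 < -(D q (1, 0) + Ue q.1 q.2 * D q (0, 1))
  · obtain ⟨p, hp, hp'⟩ := (isCompact_Icc.prod isCompact_Icc).exists_forall_le' hc hpos
    exact ⟨p, hp, fun P hB _ t ht x hx => (heq P hB t ht x hx) ▸ hp' (t, x) ⟨ht, hx⟩⟩
  · refine ⟨1, one_pos, fun P hB hA => absurd (fun q hq => ?_) hpos⟩
    rw [heq P hB q.1 hq.1 q.2 hq.2]
    exact hA q.1 hq.1 q.2 hq.2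

/-- If the energies on the boxes `[δ, L - δ] × [δ, δ⁻¹]` of a continuous profile do not exceed `K`
for arbitrarily small `δ`, then neither does the full weighted integral. -/
theorem lintegral_le_of_frequently {L K : ℝ} {f : ℝ → ℝ → ℝ}
    (hf : ContinuousOn (fun q : ℝ × ℝ => f q.1 q.2) (Icc 0 L ×ˢ Ici 0))
    (hf0 : ∀ x ∈ Icc 0 L, ∀ y ≥ 0, 0 ≤ f x y)
    (hfreq : ∃ᶠ δ in 𝓝[>] (0 : ℝ),
      (∫ x in δ..(L - δ), (L - x) ^ (3 / 2 : ℝ) * ∫ y in δ..δ⁻¹, cutoff δ⁻¹ y * f x y) ≤ K)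
    (hL : 0 < L) :
    ∫⁻ y in Ioi (0 : ℝ), ∫⁻ x in Icc 0 L, ENNReal.ofReal ((L - x) ^ (3 / 2 : ℝ) * f x y) ≤
      ENNReal.ofReal K := by
  set S : Set (ℝ × ℝ) := Ioo 0 L ×ˢ Ioi 0 with hS
  have hSm : MeasurableSet S := measurableSet_Ioo.prod measurableSet_Ioi
  have hSsub : S ⊆ Icc 0 L ×ˢ Ici 0 := prod_mono Ioo_subset_Icc_self Ioi_subset_Ici_self
  have cφ : Continuous fun q : ℝ × ℝ => (L - q.1) ^ (3 / 2 : ℝ) :=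
    (continuous_weight L).comp continuous_fst
  have cg : ContinuousOn (fun q : ℝ × ℝ => (L - q.1) ^ (3 / 2 : ℝ) * f q.1 q.2)
      (Icc 0 L ×ˢ Ici 0) := cφ.continuousOn.mul hf
  have hμ : (volume.restrict (Ioo 0 L)).prod (volume.restrict (Ioi (0 : ℝ))) =
      (volume : Measure (ℝ × ℝ)).restrict S := by
    rw [Measure.prod_restrict]; rfl
  have hm : AEMeasurable (fun q : ℝ × ℝ => ENNReal.ofReal ((L - q.1) ^ (3 / 2 : ℝ) * f q.1 q.2))
      ((volume : Measure (ℝ × ℝ)).restrict S) :=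
    ((cg.mono hSsub).aemeasurable hSm).ennreal_ofReal
  have e₁ : ∫⁻ y in Ioi (0 : ℝ), ∫⁻ x in Icc 0 L,
      ENNReal.ofReal ((L - x) ^ (3 / 2 : ℝ) * f x y) =
      ∫⁻ q in S, ENNReal.ofReal ((L - q.1) ^ (3 / 2 : ℝ) * f q.1 q.2) := by
    rw [← Measure.restrict_congr_set (Ioo_ae_eq_Icc (μ := volume) (a := (0 : ℝ)) (b := L)), ← hμ,
      lintegral_prod_symm _ (by rw [hμ]; exact hm)]
  rw [e₁]
  -- A sequence δ n → 0 realising the bound; δ n < L/2 and δ n < 1 keep both sides of the box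
  -- correctly ordered.
  obtain ⟨δ, hδ0, hδ⟩ := exists_seq_forall_of_frequently
    (hfreq.and_eventually (Ioo_mem_nhdsGT (lt_min (half_pos hL) one_pos)))
  have hδ' : Tendsto δ atTop (𝓝 0) := hδ0.mono_right nhdsWithin_le_nhds
  have hδpos : ∀ n, 0 < δ n := fun n => (hδ n).2.1
  have hδinv : Tendsto (fun n => (δ n)⁻¹) atTop atTop :=
    tendsto_inv_nhdsGT_zero.comp hδ0
  let B : ℕ → Set (ℝ × ℝ) := fun n => Icc (δ n) (L - δ n) ×ˢ Icc (δ n) (δ n)⁻¹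
  have hBm : ∀ n, MeasurableSet (B n) := fun n => measurableSet_Icc.prod measurableSet_Icc
  have hBS : ∀ n, B n ⊆ S := fun n q hq =>
    ⟨⟨(hδpos n).trans_le hq.1.1, by linarith [hq.1.2, hδpos n]⟩, (hδpos n).trans_le hq.2.1⟩
  let F : ℕ → ℝ × ℝ → ℝ := fun n q => (L - q.1) ^ (3 / 2 : ℝ) * (cutoff (δ n)⁻¹ q.2 * f q.1 q.2)
  have cF : ∀ n, ContinuousOn (F n) (Icc 0 L ×ˢ Ici 0) := fun n =>
    cφ.continuousOn.mul (((continuous_cutoff _).comp continuous_snd).continuousOn.mul hf)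
  have hFm : ∀ n, AEMeasurable ((B n).indicator fun q => ENNReal.ofReal (F n q))
      ((volume : Measure (ℝ × ℝ)).restrict S) := fun n =>
    ((((cF n).mono hSsub).aemeasurable hSm).ennreal_ofReal).indicator (hBm n)
  have hlim : ∀ q ∈ S, Tendsto (fun n => (B n).indicator (fun q => ENNReal.ofReal (F n q)) q) atTop
      (𝓝 (ENNReal.ofReal ((L - q.1) ^ (3 / 2 : ℝ) * f q.1 q.2))) := by
    intro q hq
    have h1 : Tendsto (fun n => F n q) atTop (𝓝 ((L - q.1) ^ (3 / 2 : ℝ) * (1 * f q.1 q.2))) := by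
      refine Tendsto.const_mul _ (Tendsto.mul_const _ ?_)
      have : Tendsto (fun n => (1 - q.2 * δ n) ^ 2) atTop (𝓝 ((1 - q.2 * 0) ^ 2)) :=
        ((hδ'.const_mul q.2).const_sub 1).pow 2
      simpa [cutoff, div_inv_eq_mul] using this
    rw [one_mul] at h1
    refine (ENNReal.tendsto_ofReal h1).congr' ?_
    have a₁ : ∀ᶠ n in atTop, δ n < min (min q.1 (L - q.1)) q.2 :=
      hδ'.eventually (gt_mem_nhds (lt_min (lt_min hq.1.1 (sub_pos.2 hq.1.2)) hq.2))
    filter_upwards [a₁, hδinv.eventually_ge_atTop q.2] with n h2 h3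
    have h4 : δ n < min q.1 (L - q.1) := h2.trans_le (min_le_left _ _)
    have h5 : δ n < q.1 := h4.trans_le (min_le_left _ _)
    have h6 : δ n < L - q.1 := h4.trans_le (min_le_right _ _)
    have h7 : δ n < q.2 := h2.trans_le (min_le_right _ _)
    rw [indicator_of_mem]
    exact ⟨⟨h5.le, by linarith⟩, h7.le, h3⟩
  have h_integral : ∀ n, ∫⁻ q in S, (B n).indicator (fun q => ENNReal.ofReal (F n q)) q ≤
      ENNReal.ofReal K := by
    intro n
    have hδL : δ n < L / 2 := (hδ n).2.2.trans_le (min_le_left _ _)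
    have hδ1 : δ n < 1 := (hδ n).2.2.trans_le (min_le_right _ _)
    have hδi : δ n ≤ (δ n)⁻¹ := hδ1.le.trans ((one_le_inv₀ (hδpos n)).2 hδ1.le)
    rw [lintegral_indicator (hBm n), Measure.restrict_restrict (hBm n),
      inter_eq_left.2 (hBS n)]
    have hcB : ContinuousOn (F n) (B n) := (cF n).mono ((hBS n).trans hSsub)
    have hiB : IntegrableOn (F n) (B n) (volume.prod volume) :=
      hcB.integrableOn_compact (isCompact_Icc.prod isCompact_Icc)
    have hnn : 0 ≤ᵐ[volume.restrict (B n)] F n := by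
      filter_upwards [ae_restrict_mem (hBm n)] with q hq
      have hq' := hSsub (hBS n hq)
      exact mul_nonneg (weight_nonneg hq'.1.2)
        (mul_nonneg (cutoff_nonneg _ _) (hf0 q.1 hq'.1 q.2 hq'.2))
    have hiB' : IntegrableOn (F n) (B n) volume := hiB
    rw [← ofReal_integral_eq_lintegral_ofReal hiB' hnn]
    refine ENNReal.ofReal_le_ofReal (le_trans (le_of_eq ?_) (hδ n).1)
    have : ∫ q in B n, F n q = ∫ x in Icc (δ n) (L - δ n), ∫ y in Icc (δ n) (δ n)⁻¹, F n (x, y) :=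
      setIntegral_prod (F n) hiB
    rw [this, integral_Icc_eq_integral_Ioc, ← intervalIntegral.integral_of_le (by linarith)]
    refine intervalIntegral.integral_congr fun x _ => ?_
    simp only [F]
    rw [integral_Icc_eq_integral_Ioc, ← intervalIntegral.integral_of_le hδi,
      intervalIntegral.integral_const_mul]
  -- Fatou's lemma: the truncated integrands converge pointwise on the open strip, and their
  -- integrals stay below K.
  calc ∫⁻ q in S, ENNReal.ofReal ((L - q.1) ^ (3 / 2 : ℝ) * f q.1 q.2)
      = ∫⁻ q in S, liminf (fun n => (B n).indicator (fun q => ENNReal.ofReal (F n q)) q) atTop :=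
        setLIntegral_congr_fun hSm fun q hq => (hlim q hq).liminf_eq.symm
    _ ≤ liminf (fun n => ∫⁻ q in S, (B n).indicator (fun q => ENNReal.ofReal (F n q)) q) atTop :=
        lintegral_liminf_le' hFm
    _ ≤ ENNReal.ofReal K := by
        refine (liminf_le_liminf (Eventually.of_forall h_integral)).trans_eq ?_
        simp

/-! ### Contradiction from everywhere positive vorticity. -/

namespace IsClassicalSolution

variable {T L : ℝ} {Ue P u₀ u₁ : ℝ → ℝ → ℝ} {u v : ℝ → ℝ → ℝ → ℝ}

theorem initialFunctional_eq (h : IsClassicalSolution T L Ue P u₀ u₁ u v) :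
    initialFunctional L u₀ = ∫⁻ y in Ioi (0 : ℝ), ∫⁻ x in Icc 0 L,
      ENNReal.ofReal ((L - x) ^ (3 / 2 : ℝ) * ratio u 0 x y) := by
  refine setLIntegral_congr_fun measurableSet_Ioi fun y hy => ?_
  refine setLIntegral_congr_fun measurableSet_Icc fun x hx => ?_
  have hy' : (0 : ℝ) ≤ y := le_of_lt hy
  simp only [ratio, angle]
  rw [h.partialY_initial hx hy', h.initial x hx y hy', mul_div_assoc]

/-- Eventually the energies of the initial data on the boxes `[δ, L - δ] × [δ, δ⁻¹]` exceed any
number below the initial functional. -/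
theorem eventually_lt_energy (h : IsClassicalSolution T L Ue P u₀ u₁ u v)
    (hw : PosVorticity T L u) (hT : 0 < T) (hL : 0 < L) {K C : ℝ} (hC : 0 < C) (hKC : K < C)
    (hini : ENNReal.ofReal C ≤ initialFunctional L u₀) :
    ∀ᶠ δ in 𝓝[>] (0 : ℝ), K < energy L u δ (L - δ) δ δ⁻¹ 0 := by
  by_contra hcon
  have hfreq : ∃ᶠ δ in 𝓝[>] (0 : ℝ), energy L u δ (L - δ) δ δ⁻¹ 0 ≤ K := by
    simpa only [Filter.Frequently, not_le] using hcon
  have h0 : (0 : ℝ) ∈ Ico 0 T := ⟨le_rfl, hT⟩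
  have hle := lintegral_le_of_frequently (f := ratio u 0)
    ((h.continuousOn_ratio hw).comp (f := fun q : ℝ × ℝ => (0, q.1, q.2)) (by fun_prop)
      fun q hq => ⟨h0, hq.1, hq.2⟩)
    (fun x hx y hy => angle_nonneg _ (hw 0 h0 x hx y hy).le) hfreq hL
  rw [← h.initialFunctional_eq] at hle
  have := (hini.trans hle)
  rw [ENNReal.ofReal_le_ofReal_iff'] at this
  rcases this with h1 | h1 <;> linarith

/-- If the vorticity stays positive, the initial functional cannot be large. -/
theorem false_of_posVorticity (h : IsClassicalSolution T L Ue P u₀ u₁ u v)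
    (hw : PosVorticity T L u) (hT : 0 < T) (hL : 0 < L)
    (hUe : ContinuousOn (fun q : ℝ × ℝ => Ue q.1 q.2) (Icc 0 T ×ˢ Icc 0 L))
    (hUe_pos : ∀ t ∈ Icc 0 T, ∀ x ∈ Icc 0 L, 0 < Ue t x) {p U c C K : ℝ} (hp : 0 < p)
    (hpP : ∀ t ∈ Icc 0 T, ∀ x ∈ Icc 0 L, p ≤ pressureGradient L P t x)
    (hU0 : 0 < U) (hU : ∀ t ∈ Icc 0 T, ∀ x ∈ Icc 0 L, Ue t x ≤ U)
    (hc : c = p / (4 * (√U * (L ^ (3 / 2 : ℝ) * L)) ^ 2))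
    (hC : C = 5 * (L ^ (3 / 2 : ℝ) * L) + U * L ^ (3 / 2 : ℝ))
    (hK1 : 1 ≤ K) (hK2 : (C + 2) / c < K) (hK3 : 2 / (T / 2) ≤ K)
    (hini : ENNReal.ofReal (K + 1) ≤ initialFunctional L u₀) : False := by
  -- The derivative bounds and the far-field limit are uniform only up to times T' < T, so the
  -- blow-up is arranged to happen within [0, T/2].
  have hτ : T / 2 < T := half_lt_self hT
  have hL32 : 0 < L ^ (3 / 2 : ℝ) := Real.rpow_pos_of_pos hL _
  have hsU : 0 < √U := Real.sqrt_pos.2 hU0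
  set k := √U * (L ^ (3 / 2 : ℝ) * L) with hk
  have hk0 : 0 < k := by positivity
  obtain ⟨N₀, hN₀1, hN₀⟩ := h.exists_cutoff_width hw hUe hUe_pos hτ
  obtain ⟨ε₀, hε₀, hwall⟩ := h.exists_wall_distance hw hτ
  have hinv : ∀ᶠ δ in 𝓝[>] (0 : ℝ), N₀ ≤ δ⁻¹ := tendsto_inv_nhdsGT_zero.eventually_ge_atTop N₀
  -- One δ serves as the margin in x, the distance from the wall and the inverse width of the
  -- cutoff. It depends on the solution, but c, C and K do not.
  obtain ⟨δ, hδK, hδN, hδ0, hδ⟩ := ((h.eventually_lt_energy hw hT hL (K := K) (by linarith)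
    (by linarith) hini).and (hinv.and (Ioo_mem_nhdsGT
      (lt_min (lt_min hε₀ (half_pos hL)) one_pos)))).exists
  have hδε : δ < ε₀ := hδ.trans_le ((min_le_left _ _).trans (min_le_left _ _))
  have hδL : δ < L / 2 := hδ.trans_le ((min_le_left _ _).trans (min_le_right _ _))
  have hδ1 : δ < 1 := hδ.trans_le (min_le_right _ _)
  have hN1 : 1 ≤ δ⁻¹ := hN₀1.trans hδN
  have hδi : δ ≤ δ⁻¹ := hδ1.le.trans hN1
  have hderiv : ∀ t ∈ Ioo 0 (T / 2), ∃ A', HasDerivAt (energy L u δ (L - δ) δ δ⁻¹) A' t ∧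
      ∀ lam ≥ 0, (3 * p * lam ^ 2 - 1 / 3) * energy L u δ (L - δ) δ δ⁻¹ t -
        (4 * p * lam ^ 3 * √U + 5) * (L ^ (3 / 2 : ℝ) * L) - U * L ^ (3 / 2 : ℝ) ≤ A' := by
    intro t ht
    have htT : t ∈ Icc 0 T := ⟨ht.1.le, by linarith [ht.2]⟩
    have htI : t ∈ Icc 0 (T / 2) := ⟨ht.1.le, ht.2.le⟩
    refine h.hasDerivAt_energy hw ⟨ht.1, ht.2.trans hτ⟩ hδ0 (by linarith) (by linarith) hδ0 hδi
      hp.le (hpP t htT) (hU t htT) fun x hx => ?_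
    have h1 := hN₀ δ⁻¹ hδN t htI x hx δ ⟨hδ0, hδ1.le⟩
    obtain ⟨h2, h3⟩ := hwall δ ⟨hδ0, hδε⟩ t htI x hx
    have hpos := hw t ⟨ht.1.le, ht.2.trans hτ⟩ x hx δ hδ0.le
    have h4 := boundary_terms_le hN1 ⟨hδ0.le, hδi⟩ h2 h3 (angle_nonneg (u t x δ) hpos.le)
      (angle_le_one (u t x δ) hpos)
    have h5 : ratio u t x δ = angle (u t x δ) (partialY u t x δ) := rfl
    rw [← h5] at h4
    linarith
  choose! A' hA' hineq using hderiv
  refine false_of_superquadratic (A := energy L u δ (L - δ) δ δ⁻¹) (A' := A') (c := c) (C := C)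
    (τ := T / 2) (K := K) (by rw [hc]; positivity) (by rw [hC]; positivity) (half_pos hT)
    (h.continuousOn_energy hw hτ hδ0.le (by linarith) (by linarith) hδ0.le hδi) hA' ?_ hK1 hK2
    hK3 hδK
  intro t ht hA
  set A := energy L u δ (L - δ) δ δ⁻¹ t with hAdef
  -- This λ maximises 3pλ²A - 4pλ³k over λ ≥ 0, with value pA³/(4k²) = cA³.
  have h1 := hineq t ht (A / (2 * k)) (by positivity)
  rw [← hAdef] at h1
  refine le_trans ?_ h1
  have e : (3 * p * (A / (2 * k)) ^ 2 - 1 / 3) * A -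
      (4 * p * (A / (2 * k)) ^ 3 * √U + 5) * (L ^ (3 / 2 : ℝ) * L) - U * L ^ (3 / 2 : ℝ) =
      3 * p * (A / (2 * k)) ^ 2 * A - 4 * p * (A / (2 * k)) ^ 3 * k - A / 3 - C := by
    rw [hC, hk]; ring
  have e2 : 3 * p * (A / (2 * k)) ^ 2 * A - 4 * p * (A / (2 * k)) ^ 3 * k = c * A ^ 3 := by
    rw [hc]; field_simp; ring
  rw [e, e2]
  linarith

end IsClassicalSolution

end Prandtl

/-! ### The main theorem. -/

theorem theorem1p1 (T L : ℝ) (hT : 0 < T) (hL : 0 < L) (Ue : ℝ → ℝ → ℝ)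
    (hUe : ContDiffOn ℝ 1 (fun q : ℝ × ℝ => Ue q.1 q.2) (Icc 0 T ×ˢ Icc 0 L))
    (hUe_pos : ∀ t ∈ Icc 0 T, ∀ x ∈ Icc 0 L, 0 < Ue t x) :
    (∀ (P u₀ u₁ : ℝ → ℝ → ℝ) (u v : ℝ → ℝ → ℝ → ℝ),
      Prandtl.Bernoulli T L Ue P → Prandtl.AdversePressure T L P →
      Prandtl.MonotoneData T L u₀ u₁ →
      Prandtl.IsClassicalSolution T L Ue P u₀ u₁ u v →
        (∀ t₀ x₀ y₀ : ℝ, Prandtl.IsFirstCriticalPoint T L u t₀ x₀ y₀ → y₀ = 0) ∧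
        ((∃ t ∈ Ioo 0 T, ∃ x ∈ Icc 0 L, ∃ y ≥ 0, Prandtl.partialY u t x y = 0) →
          ∃ t₀ x₀ : ℝ, Prandtl.IsFirstCriticalPoint T L u t₀ x₀ 0)) ∧
    (∃ C : ℝ, 0 < C ∧
      ∀ (P u₀ u₁ : ℝ → ℝ → ℝ) (u v : ℝ → ℝ → ℝ → ℝ),
      Prandtl.Bernoulli T L Ue P → Prandtl.AdversePressure T L P →
      Prandtl.MonotoneData T L u₀ u₁ →
      Prandtl.IsClassicalSolution T L Ue P u₀ u₁ u v →
      ENNReal.ofReal C ≤ Prandtl.initialFunctional L u₀ →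
        ∃ t' ∈ Ioo 0 T, ∃ x' ∈ Icc 0 L,
          Prandtl.IsBackFlowPoint u t' x' ∧
          (∀ t ∈ Ico 0 t', ∀ x ∈ Icc 0 L, ∀ y ≥ 0, 0 < Prandtl.partialY u t x y) ∧
          Prandtl.partialY (Prandtl.partialY u) t' x' 0 = Prandtl.pressureGradient L P t' x' ∧
          Prandtl.partialY (Prandtl.partialY u) t' x' 0 ≠ 0) := by
  have hUc := hUe.continuousOn
  refine ⟨fun P u₀ u₁ u v _ _ hD h => ⟨fun t₀ x₀ y₀ hc => h.firstCriticalPoint_on_wall hL hD hc,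
    fun hz => h.exists_firstCriticalPoint hL hD hUc hUe_pos hz⟩, ?_⟩
  obtain ⟨p, hp, hpP⟩ := Prandtl.exists_pressure_lower_bound hT hL hUe
  obtain ⟨U₀, hU₀⟩ := (isCompact_Icc.prod isCompact_Icc).exists_bound_of_continuousOn hUc
  have hU : ∀ t ∈ Icc 0 T, ∀ x ∈ Icc 0 L, Ue t x ≤ max U₀ 1 := fun t ht x hx =>
    ((le_abs_self _).trans (hU₀ (t, x) ⟨ht, hx⟩)).trans (le_max_left _ _)
  -- The maximum with 1 makes the upper bound of U_e positive by construction.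
  set U := max U₀ 1
  set C := 5 * (L ^ (3 / 2 : ℝ) * L) + U * L ^ (3 / 2 : ℝ) with hC
  set c := p / (4 * (√U * (L ^ (3 / 2 : ℝ) * L)) ^ 2) with hc
  -- K meets the three thresholds of `false_of_superquadratic`. The constant of the theorem is K +
  -- 1, which leaves room for truncated energies that fall short of the full integral.
  set K := max (max 1 (2 / (T / 2))) ((C + 2) / c + 1)
  have hK1 : 1 ≤ K := (le_max_left _ _).trans (le_max_left _ _)
  have hK2 : (C + 2) / c < K := (lt_add_one _).trans_le (le_max_right _ _)
  have hK3 : 2 / (T / 2) ≤ K := (le_max_right _ _).trans (le_max_left _ _)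
  refine ⟨K + 1, by linarith, fun P u₀ u₁ u v hB hA hD h hini => ?_⟩
  have hzero : ∃ t ∈ Ioo 0 T, ∃ x ∈ Icc 0 L, ∃ y ≥ 0, Prandtl.partialY u t x y = 0 := by
    -- No zero at positive times, together with positive initial vorticity, gives positivity
    -- everywhere by the intermediate value theorem in t.
    by_contra! hne
    have hw : Prandtl.PosVorticity T L u := fun t ht x hx y hy =>
      h.uy_pos_of_ne_zero hD ht hx hy fun s hs => by
        rcases hs.1.eq_or_lt with rfl | hs0
        · exact (h.uy_initial_pos hD hx hy).ne'
        · exact hne s ⟨hs0, hs.2.trans_lt ht.2⟩ x hx y hy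
    exact h.false_of_posVorticity hw hT hL hUc hUe_pos hp (hpP P hB hA)
      (by positivity : 0 < U) hU hc hC hK1 hK2 hK3 hini
  obtain ⟨t', x', hcrit⟩ := h.exists_firstCriticalPoint hL hD hUc hUe_pos hzero
  have hpos : ∀ t ∈ Ico 0 t', ∀ x ∈ Icc 0 L, ∀ y ≥ 0, 0 < Prandtl.partialY u t x y :=
    fun t ht x hx y hy => h.uy_pos_of_ne_zero hD ⟨ht.1, ht.2.trans hcrit.mem_t.2⟩ hx hy
      fun s hs => hcrit.first s ⟨hs.1, hs.2.trans_lt ht.2⟩ x hx y hy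
  have hbal := h.wall_balance (Ioo_subset_Ico_self hcrit.mem_t) hcrit.mem_x
  refine ⟨t', hcrit.mem_t, x', hcrit.mem_x, ⟨hcrit.zero, fun t ht x hx => ?_⟩, hpos, hbal, ?_⟩
  · exact hpos t (Ioo_subset_Ico_self ht) x ⟨hx.1.le, hx.2.le.trans hcrit.mem_x.2⟩ 0 le_rfl
  · rw [hbal]
    exact (hA t' (Ioo_subset_Icc_self hcrit.mem_t) x' hcrit.mem_x).ne'
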